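/- Consider the square lattice $\mathbb Z^2=\mathbb Z+i\mathbb Z\subset\mathbb C$ with mesh size $1$ and edges between nearest neighbours. For a box $\Lambda_N=[-N,N]^2\cap\mathbb Z^2$, with the lattice edges between its sites, let $\partial\Lambda_N$ be the set of sites of $\Lambda_N$ with fewer than four neighbours in $\Lambda_N$. For a partition $\psi$ of $\partial\Lambda_N$ (a boundary condition) and $p\in[0,1]$, the FK-Ising measure $\phi^{\psi}_{p,\Lambda_N}$ gives to each set $\omega$ of open edges of $\Lambda_N$ a probability proportional to $$p^{o(\omega)}(1-p)^{c(\omega)}\,2^{k(\omega,\psi)},$$ where $o(\omega)$ and $c(\omega)$ are the numbers of open and closed edges and $k(\omega,\psi)$ is the number of connected components of the graph obtained from $(\Lambda_N,\omega)$ by identifying the boundary sites in the same class of $\psi$. An infinite-volume FK-Ising measure with parameter $p$ is a probability measure $\phi_p$ on $\{\text{open},\text{closed}\}^{E(\mathbb Z^2)}$ such that, for some $N_1<N_2<\cdots$ and some boundary conditions $\psi_k$ on $\Lambda_{N_k}$, $\phi^{\psi_k}_{p,\Lambda_{N_k}}(A)\to\phi_p(A)$ as $k\to\infty$ for every event $A$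 depending on finitely many edges. Write $x\leftrightarrow y$ if $x$ and $y$ are joined by a path of open edges. **Proposition.** Let $0\le p<\sqrt2/(1+\sqrt2)$. There exists $\xi=\xi(p)>0$ such that, for every infinite-volume FK-Ising measure $\phi_p$ with parameter $p$ and every integer $n\ge0$, $$\phi_p(0\leftrightarrow in)\le e^{-\xi n}.$$ -/

import Mathlib

open MeasureTheory Filter Topology

noncomputable section

namespace FK

/-- The square lattice `ℤ² = ℤ + iℤ ⊂ ℂ` of mesh size one; the pair `(a, b)` is the site `a + ib`. -/
def squareLattice : SimpleGraph (ℤ × ℤ) where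
  Adj x y := |x.1 - y.1| + |x.2 - y.2| = 1
  symm := ⟨fun x y h => by rw [abs_sub_comm y.1, abs_sub_comm y.2]; exact h⟩
  loopless := ⟨fun x h => by simp at h⟩

/-- Percolation configurations on the whole lattice: `ω e = true` means that `e` is open. They
carry the product σ-algebra, generated by the events that depend on finitely many edges. -/
abbrev Config : Type := squareLattice.edgeSet → Bool

/-- The subgraph of the lattice formed by all sites and the open edges of `ω`. -/
def openGraph (ω : Config) : SimpleGraph (ℤ × ℤ) :=
  SimpleGraph.fromEdgeSet {e | ∃ h : e ∈ squareLattice.edgeSet, ω ⟨e, h⟩ = true}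

/-- `x ↔ y`: there is a path of open edges from `x` to `y`. -/
def Connected (ω : Config) (x y : ℤ × ℤ) : Prop :=
  (openGraph ω).Reachable x y

/-- The box `[-N, N]²`. -/
def box (N : ℕ) : Finset (ℤ × ℤ) :=
  Finset.Icc (-(N : ℤ)) N ×ˢ Finset.Icc (-(N : ℤ)) N

open Classical in
/-- The edges of the lattice with both endpoints in `Λ`. -/
def edgesIn (Λ : Finset (ℤ × ℤ)) : Finset squareLattice.edgeSet :=
  Λ.sym2.subtype (· ∈ squareLattice.edgeSet)

open Classical in
/-- The sites of `Λ` with fewer than four neighbours in `Λ`. -/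
def boundary (Λ : Finset (ℤ × ℤ)) : Finset (ℤ × ℤ) :=
  Λ.filter fun x => (Λ.filter fun y => squareLattice.Adj x y).card < 4

/-- A boundary condition on `Λ` is a partition of the boundary of `Λ`, given as an equivalence
relation; `⊥` is the free and `⊤` the wired boundary condition. -/
abbrev BoundaryCondition (Λ : Finset (ℤ × ℤ)) : Type := Setoid (boundary Λ)

open Classical in
/-- The configuration whose open edges are exactly those of `S`. -/
def ofOpenEdges (S : Finset squareLattice.edgeSet) : Config := fun e => decide (e ∈ S)

/-- The graph with vertex set `Λ` whose edges are the open edges `S` inside `Λ`, together with an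
edge between any two distinct boundary sites in the same class of `ξ`. Its connected components are
those of the graph obtained by identifying the boundary sites of each class. -/
def wiredGraph (Λ : Finset (ℤ × ℤ)) (ξ : BoundaryCondition Λ) (S : Finset squareLattice.edgeSet) :
    SimpleGraph Λ :=
  (openGraph (ofOpenEdges S)).comap Subtype.val ⊔
    SimpleGraph.fromRel fun x y : Λ =>
      ∃ (hx : x.1 ∈ boundary Λ) (hy : y.1 ∈ boundary Λ), ξ ⟨x.1, hx⟩ ⟨y.1, hy⟩

/-- The number `k(ω, ξ)` of clusters. -/
def numClusters (Λ : Finset (ℤ × ℤ)) (ξ : BoundaryCondition Λ)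
    (S : Finset squareLattice.edgeSet) : ℕ :=
  Nat.card (wiredGraph Λ ξ S).ConnectedComponent

/-- The weight `p ^ o(ω) * (1 - p) ^ c(ω) * q ^ k(ω, ξ)` of the configuration on `Λ` with set of
open edges `S ⊆ edgesIn Λ`. -/
def weight (p q : ℝ) (Λ : Finset (ℤ × ℤ)) (ξ : BoundaryCondition Λ)
    (S : Finset squareLattice.edgeSet) : ℝ :=
  p ^ S.card * (1 - p) ^ ((edgesIn Λ).card - S.card) * q ^ numClusters Λ ξ S

/-- The partition function. -/
def partitionFunction (p q : ℝ) (Λ : Finset (ℤ × ℤ)) (ξ : BoundaryCondition Λ) : ℝ :=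
  ∑ S ∈ (edgesIn Λ).powerset, weight p q Λ ξ S

/-- The FK percolation measure on the finite graph `Λ` with parameters `p, q` and boundary
condition `ξ`, seen as a measure on configurations of the whole lattice in which the edges that are
not in `Λ` are closed. -/
def finiteVolume (p q : ℝ) (Λ : Finset (ℤ × ℤ)) (ξ : BoundaryCondition Λ) : Measure Config :=
  ∑ S ∈ (edgesIn Λ).powerset,
    ENNReal.ofReal (weight p q Λ ξ S / partitionFunction p q Λ ξ) • Measure.dirac (ofOpenEdges S)

/-- `φ` is an infinite-volume FK percolation measure with parameters `p, q`: a probability measure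
that is the limit, on all events depending on finitely many edges, of finite-volume measures on a
sequence of boxes increasing to the lattice, with some boundary conditions on these boxes. -/
def IsInfiniteVolume (p q : ℝ) (φ : Measure Config) : Prop :=
  IsProbabilityMeasure φ ∧
    ∃ (N : ℕ → ℕ) (ξ : ∀ k, BoundaryCondition (box (N k))), StrictMono N ∧
      ∀ (E : Finset squareLattice.edgeSet) (A : Set (E → Bool)),
        Tendsto (fun k => finiteVolume p q (box (N k)) (ξ k) (cylinder E A)) atTop
          (𝓝 (φ (cylinder E A)))

end FK

end

/-! By the Edwards–Sokal coupling, the connection probability is at most the two-point function of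
the Ising model with `t = tanh β = p / (2 - p)`, and `p < √2 / (1 + √2)` means `t < √2 - 1`. By the
Simon–Lieb inequality, the two-point function from `y` is at most the sum over the sphere of radius
`m` about `y` of the two-point functions to the target, each multiplied by a correlation in the ball
with free boundary; the boundary condition of the box plays no role in these factors. By Griffiths'
inequality a factor can only increase when the ball is wrapped around a cylinder whose bottom spins
are frozen, where it becomes the magnetization at height `m`. This magnetization is a correlation of
a spin with a disorder line. Spin–disorder correlations satisfy local linear relations, which
together with the reflections and rotations of the cylinder show that one unit of height multiplies
them by exactly `t (1 + t) / (1 - t)`, which is less than `1` for `t < √2 - 1`. Hence for some `m`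
the at most `8 m` terms on the sphere add up to a factor at most `1 / 2`, which is iterated until
the distance is exhausted. Distances below `m` are covered by the effect of a single spin flip. -/

noncomputable section

namespace FK

/-! ### Positive type and high-temperature weights -/

section PosType

variable {G : Type*} [Group G]

/-- Functions of positive type on a group of spin flips: the combinations of real characters
with nonnegative coefficients. -/
inductive PosType : (G → ℝ) → Prop
  | char (χ : G →* ℝ) : PosType χ
  | add {f g : G → ℝ} : PosType f → PosType g → PosType fun x => f x + g x
  | smul {f : G → ℝ} (c : ℝ) : 0 ≤ c → PosType f → PosType fun x => c * f x

section Character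

variable [Finite G] (χ : G →* ℝ) (g : G)

theorem abs_char : |χ g| = 1 := by
  have h : |χ g| ^ orderOf g = 1 := by
    rw [← abs_pow, ← map_pow, pow_orderOf_eq_one, map_one, abs_one]
  exact (pow_eq_one_iff_of_nonneg (abs_nonneg _) (orderOf_pos g).ne').1 h

theorem char_mul_self : χ g * χ g = 1 := by
  rw [← abs_mul_abs_self, abs_char, one_mul]

theorem char_le_one : χ g ≤ 1 :=
  (le_abs_self _).trans (abs_char χ g).le

end Character

namespace PosType

variable {ι : Type*} {f g : G → ℝ}

theorem const {c : ℝ} (hc : 0 ≤ c) : PosType fun _ : G => c := by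
  simpa using (PosType.char (1 : G →* ℝ)).smul c hc

theorem const_add_char {c J : ℝ} (hc : 0 ≤ c) (hJ : 0 ≤ J) (χ : G →* ℝ) :
    PosType fun x => c + J * χ x :=
  (const hc).add ((PosType.char χ).smul J hJ)

theorem char_mul (χ : G →* ℝ) (hf : PosType f) : PosType fun x => χ x * f x := by
  induction hf with
  | char ψ => exact PosType.char (χ * ψ)
  | add _ _ h₁ h₂ => simpa only [mul_add] using h₁.add h₂
  | smul c hc _ h => simpa only [mul_left_comm] using h.smul c hc

theorem mul (hf : PosType f) (hg : PosType g) : PosType fun x => f x * g x := by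
  induction hf with
  | char ψ => exact char_mul ψ hg
  | add _ _ h₁ h₂ => simpa only [add_mul] using h₁.add h₂
  | smul c hc _ h => simpa only [mul_assoc] using h.smul c hc

theorem prod {F : Finset ι} {f : ι → G → ℝ} (h : ∀ i ∈ F, PosType (f i)) :
    PosType fun x => ∏ i ∈ F, f i x := by
  classical
  induction F using Finset.induction_on with
  | empty => simpa only [Finset.prod_empty] using const (G := G) zero_le_one
  | insert i F hi ih =>
    simp only [Finset.prod_insert hi]
    exact (h i (Finset.mem_insert_self i F)).mul
      (ih fun j hj => h j (Finset.mem_insert_of_mem hj))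

theorem sum_nonneg [Fintype G] (hf : PosType f) : 0 ≤ ∑ x, f x := by
  classical
  induction hf with
  | char χ =>
    rw [sum_hom_units]
    split_ifs <;> positivity
  | add _ _ h₁ h₂ => rw [Finset.sum_add_distrib]; exact add_nonneg h₁ h₂
  | smul c hc _ h => rw [← Finset.mul_sum]; exact mul_nonneg hc h

theorem prod_sub_and_prod_add {F : Finset ι} {a b : ι → G → ℝ}
    (hsub : ∀ i ∈ F, PosType fun x => a i x - b i x)
    (hadd : ∀ i ∈ F, PosType fun x => a i x + b i x) :
    (PosType fun x => ∏ i ∈ F, a i x - ∏ i ∈ F, b i x) ∧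
      PosType fun x => ∏ i ∈ F, a i x + ∏ i ∈ F, b i x := by
  classical
  induction F using Finset.induction_on with
  | empty =>
    simp only [Finset.prod_empty]
    exact ⟨const (by norm_num), const (by norm_num)⟩
  | insert i F hi ih =>
    obtain ⟨hFsub, hFadd⟩ := ih (fun j hj => hsub j (Finset.mem_insert_of_mem hj))
      fun j hj => hadd j (Finset.mem_insert_of_mem hj)
    have hisub := hsub i (Finset.mem_insert_self i F)
    have hiadd := hadd i (Finset.mem_insert_self i F)
    simp only [Finset.prod_insert hi]
    constructor
    · convert ((hisub.mul hFadd).add (hiadd.mul hFsub)).smul (1 / 2) (by norm_num) using 2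
      ring
    · convert ((hiadd.mul hFadd).add (hisub.mul hFsub)).smul (1 / 2) (by norm_num) using 2
      ring

end PosType

end PosType

section Boltzmann

variable {G ι : Type*} [Group G]

/-- The Gibbs weight of the couplings `F` in high-temperature form: up to a constant,
`exp (∑ i ∈ F, β i * χ i g)` equals this product with `J i = tanh (β i)`, and `J i = 1` imposes the
constraint `χ i g = 1`. -/
def boltzmann (F : Finset ι) (J : ι → ℝ) (χ : ι → G →* ℝ) (g : G) : ℝ :=
  ∏ i ∈ F, (1 + J i * χ i g)

variable {F : Finset ι} {J K : ι → ℝ} {χ : ι → G →* ℝ}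

theorem boltzmann_one : boltzmann F J χ 1 = ∏ i ∈ F, (1 + J i) := by
  simp [boltzmann]

theorem boltzmann_posType (hJ : ∀ i ∈ F, 0 ≤ J i) : PosType (boltzmann F J χ) :=
  PosType.prod fun i hi => PosType.const_add_char zero_le_one (hJ i hi) (χ i)

theorem boltzmann_mul_left (g σ : G) :
    boltzmann F J χ (g * σ) = boltzmann F (fun i => J i * χ i g) χ σ := by
  simp only [boltzmann, map_mul, mul_assoc]

theorem boltzmann_congr (h : ∀ i ∈ F, J i = K i) (σ : G) :
    boltzmann F J χ σ = boltzmann F K χ σ :=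
  Finset.prod_congr rfl fun i hi => by rw [h i hi]

theorem boltzmann_mul_of_char_eq_one {g : G} (h : ∀ i ∈ F, χ i g = 1) (σ : G) :
    boltzmann F J χ (g * σ) = boltzmann F J χ σ := by
  rw [boltzmann_mul_left]
  exact boltzmann_congr (fun i hi => by rw [h i hi, mul_one]) σ

theorem boltzmann_mul_of_eq_neg {i₀ : ι} (hi₀ : i₀ ∈ F) (h₀ : K i₀ = -J i₀)
    (h : ∀ i ∈ F, i ≠ i₀ → K i = J i) (σ : G) :
    boltzmann F K χ σ * (1 + J i₀ * χ i₀ σ) = boltzmann F J χ σ * (1 - J i₀ * χ i₀ σ) := by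
  classical
  have hrest : ∏ i ∈ F.erase i₀, (1 + K i * χ i σ) = ∏ i ∈ F.erase i₀, (1 + J i * χ i σ) :=
    Finset.prod_congr rfl fun i hi => by
      rw [h i (Finset.mem_of_mem_erase hi) (Finset.ne_of_mem_erase hi)]
  rw [boltzmann, boltzmann, ← Finset.mul_prod_erase F _ hi₀, ← Finset.mul_prod_erase F _ hi₀,
    hrest, h₀]
  ring

section Finite

variable [Finite G]

theorem abs_coupling_mul_char (c : ℝ) (χ : G →* ℝ) (σ : G) : |c * χ σ| = |c| := by
  rw [abs_mul, abs_char, mul_one]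

theorem boltzmann_nonneg (hJ : ∀ i ∈ F, |J i| ≤ 1) (σ : G) : 0 ≤ boltzmann F J χ σ :=
  Finset.prod_nonneg fun i hi => by
    have := neg_le_of_abs_le ((abs_coupling_mul_char (J i) (χ i) σ).trans_le (hJ i hi))
    linarith

theorem boltzmann_pos (hJ : ∀ i ∈ F, |J i| < 1) (σ : G) : 0 < boltzmann F J χ σ :=
  Finset.prod_pos fun i hi => by
    have := neg_lt_of_abs_lt ((abs_coupling_mul_char (J i) (χ i) σ).trans_lt (hJ i hi))
    linarith

end Finite

theorem sum_boltzmann_le_of_abs_le [Fintype G] (h : ∀ i ∈ F, |K i| ≤ J i) :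
    ∑ σ, boltzmann F K χ σ ≤ ∑ σ, boltzmann F J χ σ := by
  have hdiff := (PosType.prod_sub_and_prod_add (F := F) (a := fun i σ => 1 + J i * χ i σ)
    (b := fun i σ => 1 + K i * χ i σ) (fun i hi => ?_) fun i hi => ?_).1.sum_nonneg
  · rwa [Finset.sum_sub_distrib, sub_nonneg] at hdiff
  · convert PosType.const_add_char le_rfl (sub_nonneg.2 (abs_le.1 (h i hi)).2) (χ i) using 2
    ring
  · convert PosType.const_add_char zero_le_two (neg_le_iff_add_nonneg.1 (abs_le.1 (h i hi)).1)
      (χ i) using 2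
    ring

end Boltzmann

/-! ### Correlation inequalities -/

section Replica

variable {G ι : Type*} [Group G] [Finite G] {G' κ : Type*} [Group G'] [Finite G']

theorem PosType.one_add_mul_one_add {J K c : ℝ} (hJ : 0 ≤ J) (hJK : J ≤ K) (hK : K ≤ 1)
    (hc : |c| ≤ 1) (ψ : G →* ℝ) : PosType fun x => (1 + K * ψ x) * (1 + J * (ψ x * c)) := by
  have hc0 : 0 ≤ 1 + c := neg_le_iff_add_nonneg'.1 (abs_le.1 hc).1
  have hKJ : K * J ≤ 1 := mul_le_one₀ hK hJ (hJK.trans hK)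
  have hconst : 0 ≤ 1 + K * J * c := by nlinarith [mul_nonneg (mul_nonneg (hJ.trans hJK) hJ) hc0]
  have hlin : 0 ≤ K + J * c := by nlinarith [mul_nonneg hJ hc0]
  convert PosType.const_add_char hconst hlin ψ using 2 with x
  linear_combination K * J * c * char_mul_self ψ x

theorem posType_boltzmann_mul_boltzmann (Φ : G' →* G) {F : Finset ι} {J : ι → ℝ}
    {X : ι → G →* ℝ} {E : Finset κ} {K : κ → ℝ} {Y : κ → G' →* ℝ} {f : ι → κ}
    (hJ : ∀ i ∈ F, J i ∈ Set.Icc 0 1) (hK : ∀ e ∈ E, K e ∈ Set.Icc 0 1) (hf : Set.InjOn f F)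
    (hJK : ∀ i ∈ F, f i ∈ E → J i ≤ K (f i))
    (hXY : ∀ i ∈ F, f i ∈ E → (X i).comp Φ = Y (f i))
    (hX : ∀ i ∈ F, f i ∉ E → (X i).comp Φ = 1) (τ : G) :
    PosType fun x => boltzmann E K Y x * boltzmann F J X (Φ x * τ) := by
  classical
  induction F using Finset.induction_on generalizing E with
  | empty =>
    simp only [boltzmann, Finset.prod_empty, mul_one]
    exact boltzmann_posType fun e he => (hK e he).1
  | insert i F hi ih =>
    simp only [Finset.forall_mem_insert] at hJ hJK hXY hX
    have hτ := abs_char (X i) τ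
    have hf' : Set.InjOn f F := hf.mono (Finset.coe_subset.2 (Finset.subset_insert i F))
    by_cases hfi : f i ∈ E
    · have hne : ∀ j ∈ F, f j ≠ f i := fun j hj h =>
        hi (hf (Finset.mem_insert_of_mem hj) (Finset.mem_insert_self i F) h ▸ hj)
      have hrest := ih (E := E.erase (f i)) hJ.2 (fun e he => hK e (Finset.mem_of_mem_erase he)) hf'
        (fun j hj h => hJK.2 j hj (Finset.mem_of_mem_erase h))
        (fun j hj h => hXY.2 j hj (Finset.mem_of_mem_erase h))
        fun j hj h => hX.2 j hj fun hjE => h (Finset.mem_erase.2 ⟨hne j hj, hjE⟩)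
      convert (PosType.one_add_mul_one_add hJ.1.1 (hJK.1 hfi) (hK _ hfi).2 hτ.le
        (Y (f i))).mul hrest using 2 with x
      simp only [boltzmann]
      rw [← Finset.mul_prod_erase E _ hfi, Finset.prod_insert hi, map_mul, ← hXY.1 hfi,
        MonoidHom.comp_apply]
      ring
    · have hfactor : 0 ≤ 1 + J i * X i τ := by nlinarith [hJ.1.1, hJ.1.2, (abs_le.1 hτ.le).1]
      convert (PosType.const hfactor).mul (ih hJ.2 hK hf' hJK.2 hXY.2 hX.2) using 2 with x
      simp only [boltzmann]
      rw [Finset.prod_insert hi, map_mul, ← MonoidHom.comp_apply, hX.1 hfi, MonoidHom.one_apply]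
      ring

end Replica

section Correlation

variable {G ι : Type*} [Group G] [Fintype G]

theorem sum_mul_sum_eq_sum_relative {G' : Type*} [Fintype G'] (h : G' → G) (f : G' → ℝ)
    (k : G → ℝ) : (∑ x, f x) * ∑ g, k g = ∑ x, ∑ τ, f x * k (h x * τ) := by
  rw [Finset.sum_mul]
  refine Finset.sum_congr rfl fun x _ => ?_
  rw [← Equiv.sum_comp (Equiv.mulLeft (h x)) k, Finset.mul_sum]
  rfl

section Griffiths

variable {G' κ : Type*} [Group G'] [Fintype G'] (Φ : G' →* G) (χ : G →* ℝ)

theorem correlation_le_of_posType {w : G → ℝ} {w' : G' → ℝ}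
    (hpos : ∀ τ : G, PosType fun x => w' x * w (Φ x * τ)) :
    (∑ σ, χ σ * w σ) * ∑ x, w' x ≤ (∑ x, χ (Φ x) * w' x) * ∑ σ, w σ := by
  have hupper : (∑ x, χ (Φ x) * w' x) * ∑ σ, w σ
      = ∑ τ, ∑ x, χ (Φ x) * (w' x * w (Φ x * τ)) := by
    rw [sum_mul_sum_eq_sum_relative Φ, Finset.sum_comm]
    simp only [mul_assoc]
  have hlower : (∑ σ, χ σ * w σ) * ∑ x, w' x
      = ∑ τ, χ τ * ∑ x, χ (Φ x) * (w' x * w (Φ x * τ)) := by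
    rw [mul_comm, sum_mul_sum_eq_sum_relative Φ, Finset.sum_comm]
    simp only [Finset.mul_sum, map_mul]
    exact Finset.sum_congr rfl fun τ _ => Finset.sum_congr rfl fun x _ => by ring
  rw [hupper, hlower]
  exact Finset.sum_le_sum fun τ _ => mul_le_of_le_one_left
    (PosType.char_mul (χ.comp Φ) (hpos τ)).sum_nonneg (char_le_one χ τ)

variable {F : Finset ι} {J : ι → ℝ} {X : ι → G →* ℝ} {E : Finset κ} {K : κ → ℝ} {Y : κ → G' →* ℝ}
  {f : ι → κ}

/-- Griffiths' second inequality: a correlation increases when the spins are contracted by `Φ`, the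
couplings are raised, and new ones are added. -/
theorem correlation_le_of_contraction (hJ : ∀ i ∈ F, J i ∈ Set.Icc 0 1)
    (hK : ∀ e ∈ E, K e ∈ Set.Icc 0 1) (hf : Set.InjOn f F)
    (hJK : ∀ i ∈ F, f i ∈ E → J i ≤ K (f i))
    (hXY : ∀ i ∈ F, f i ∈ E → (X i).comp Φ = Y (f i))
    (hX : ∀ i ∈ F, f i ∉ E → (X i).comp Φ = 1) :
    (∑ σ, χ σ * boltzmann F J X σ) * ∑ x, boltzmann E K Y x ≤
      (∑ x, χ (Φ x) * boltzmann E K Y x) * ∑ σ, boltzmann F J X σ :=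
  correlation_le_of_posType Φ χ (posType_boltzmann_mul_boltzmann Φ hJ hK hf hJK hXY hX)

end Griffiths

end Correlation

section SimonLieb

variable {G P ι : Type*} [Group G]

/-- The product of the spins at the two ends of a bond. -/
def bondSpin (spin : P → G →* ℝ) (z : Sym2 P) : G →* ℝ :=
  (z.map spin).mul

@[simp]
theorem bondSpin_mk (spin : P → G →* ℝ) (x y : P) : bondSpin spin s(x, y) = spin x * spin y :=
  rfl

/-- The sites `y` and `z` are joined by a chain of the bonds in `S`, where `ends i` consists of the
two ends of `i`. -/
def Linked (ends : ι → Sym2 P) (S : Finset ι) : P → P → Prop :=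
  Relation.ReflTransGen fun y z => ∃ i ∈ S, ends i = s(y, z)

variable {spin : P → G →* ℝ} {ends : ι → Sym2 P} {S : Finset ι} {o u : P}

theorem Linked.spin_mul_boltzmann_eq [Finite G] (h : Linked ends S o u) (τ : G) :
    spin o τ * boltzmann S 1 (bondSpin spin ∘ ends) τ =
      spin u τ * boltzmann S 1 (bondSpin spin ∘ ends) τ := by
  classical
  induction h with
  | refl => rfl
  | @tail y z _ hyz ih =>
    obtain ⟨i, hi, hends⟩ := hyz
    have hbond : spin y τ * (1 + spin y τ * spin z τ) = spin z τ * (1 + spin y τ * spin z τ) := by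
      linear_combination spin z τ * char_mul_self (spin y) τ - spin y τ * char_mul_self (spin z) τ
    rw [ih, boltzmann, ← Finset.mul_prod_erase S _ hi, Function.comp_apply, hends, bondSpin_mk,
      Pi.one_apply, one_mul, MonoidHom.mul_apply, ← mul_assoc, hbond, mul_assoc]

theorem Linked.spin_mul_spin_mul_boltzmann_eq [Finite G] (h : Linked ends S o u) (τ : G) :
    (spin o * spin u) τ * boltzmann S 1 (bondSpin spin ∘ ends) τ =
      boltzmann S 1 (bondSpin spin ∘ ends) τ := by
  rw [MonoidHom.mul_apply, mul_comm (spin o τ), mul_assoc, h.spin_mul_boltzmann_eq, ← mul_assoc,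
    char_mul_self, one_mul]

theorem bondSpin_eq_one_of_linked {g : G}
    (hin : ∀ z, Linked ends S o z → spin z g = -1) (hout : ∀ z, ¬Linked ends S o z → spin z g = 1)
    {i : ι} (hi : i ∈ S) : bondSpin spin (ends i) g = 1 := by
  obtain ⟨⟨y, z⟩, hends⟩ := Quot.exists_rep (ends i)
  have hiff : Linked ends S o y ↔ Linked ends S o z :=
    ⟨fun h => h.tail ⟨i, hi, hends.symm⟩, fun h => h.tail ⟨i, hi, hends.symm.trans Sym2.eq_swap⟩⟩
  have hmul : bondSpin spin (ends i) g = spin y g * spin z g := by rw [← hends]; rfl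
  rw [hmul]
  by_cases hy : Linked ends S o y
  · rw [hin y hy, hin z (hiff.1 hy)]; norm_num
  · rw [hout y hy, hout z (mt hiff.2 hy), one_mul]

theorem setOf_linked_subset {F : Finset ι} {I D : Set P} (hSF : S ⊆ F)
    (hF : ∀ i ∈ F, ∀ y z, ends i = s(y, z) → y ∈ I → z ∈ I ∨ z ∈ D) (ho : o ∈ I)
    (hD : ∀ u ∈ D, ¬Linked ends S o u) : {z | Linked ends S o z} ⊆ I := by
  intro z hz
  induction hz with
  | refl => exact ho
  | tail hy hyz ih =>
    obtain ⟨i, hi, hends⟩ := hyz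
    exact (hF i (hSF hi) _ _ hends ih).resolve_right fun hzD => hD _ hzD (hy.tail ⟨i, hi, hends⟩)

variable {F : Finset ι} {J : ι → ℝ}

theorem boltzmann_mul_boltzmann_relative [Finite G] [DecidableEq ι] (X : ι → G →* ℝ) (σ τ : G) :
    boltzmann F J X σ * boltzmann F J X (σ * τ) =
      ∑ S ∈ F.powerset, (∏ i ∈ F \ S, (1 - J i ^ 2)) * boltzmann S 1 X τ *
        ∏ i ∈ S, J i * (J i + X i σ) := by
  have hfactor : ∀ i, (1 + J i * X i σ) * (1 + J i * X i (σ * τ))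
      = (1 + X i τ) * (J i * (J i + X i σ)) + (1 - J i ^ 2) := by
    intro i
    rw [map_mul]
    linear_combination J i ^ 2 * X i τ * char_mul_self (X i) σ
  rw [boltzmann, boltzmann, ← Finset.prod_mul_distrib]
  simp only [hfactor, boltzmann, Pi.one_apply, one_mul]
  rw [Finset.prod_add]
  exact Finset.sum_congr rfl fun S _ => by rw [Finset.prod_mul_distrib]; ring

variable [Fintype G]

/-- In terms of the relative spin of two replicas, the product of two correlations is a sum over the
sets `S` of bonds that constrain it. -/
theorem sum_char_mul_sum_boltzmann [DecidableEq ι] (X : ι → G →* ℝ) (χ : G →* ℝ) (k : G → ℝ) :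
    (∑ σ, χ σ * boltzmann F J X σ) * ∑ σ, χ σ * k σ * boltzmann F J X σ =
      ∑ S ∈ F.powerset, (∏ i ∈ F \ S, (1 - J i ^ 2)) * (∑ τ, χ τ * boltzmann S 1 X τ) *
        ∑ σ, k σ * ∏ i ∈ S, J i * (J i + X i σ) := by
  have hrelative : ∀ σ τ, χ σ * k σ * boltzmann F J X σ * (χ (σ * τ) * boltzmann F J X (σ * τ))
      = ∑ S ∈ F.powerset, (∏ i ∈ F \ S, (1 - J i ^ 2)) *
        (k σ * ∏ i ∈ S, J i * (J i + X i σ)) * (χ τ * boltzmann S 1 X τ) := by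
    intro σ τ
    trans χ τ * k σ * (boltzmann F J X σ * boltzmann F J X (σ * τ))
    · rw [map_mul]
      linear_combination
        χ τ * k σ * boltzmann F J X σ * boltzmann F J X (σ * τ) * char_mul_self χ σ
    · rw [boltzmann_mul_boltzmann_relative, Finset.mul_sum]
      exact Finset.sum_congr rfl fun S _ => by ring
  rw [mul_comm, sum_mul_sum_eq_sum_relative id]
  simp only [id, hrelative]
  simp_rw [Finset.sum_comm (s := Finset.univ) (t := F.powerset), ← Finset.mul_sum]
  refine Finset.sum_congr rfl fun S _ => ?_
  rw [← Finset.sum_mul, ← Finset.mul_sum]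
  ring

variable {v : G → ℝ} {I : Set P} {D : Finset P} {x : P}

theorem sum_unlinked_eq_zero {k : G → ℝ} (hx : ¬Linked ends S o x)
    (hflip : ∃ g : G, (∀ z, Linked ends S o z → spin z g = -1) ∧
      (∀ z, ¬Linked ends S o z → spin z g = 1) ∧ ∀ σ, k (g * σ) = k σ) :
    ∑ σ, spin o σ * spin x σ * k σ * ∏ i ∈ S, J i * (J i + bondSpin spin (ends i) σ) = 0 := by
  obtain ⟨g, hin, hout, hk⟩ := hflip
  refine self_eq_neg.1 ?_
  conv_lhs => rw [← Equiv.sum_comp (Equiv.mulLeft g)]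
  rw [← Finset.sum_neg_distrib]
  refine Finset.sum_congr rfl fun σ _ => ?_
  have hprod : ∏ i ∈ S, J i * (J i + bondSpin spin (ends i) (g * σ))
      = ∏ i ∈ S, J i * (J i + bondSpin spin (ends i) σ) :=
    Finset.prod_congr rfl fun i hi => by
      rw [map_mul, bondSpin_eq_one_of_linked hin hout hi, one_mul]
  rw [Equiv.coe_mulLeft, hprod, hk, map_mul, map_mul, hin o .refl, hout x hx]
  ring

theorem sum_boltzmann_le_sum_linked (hD : ∃ u ∈ D, Linked ends S o u) :
    ∑ τ, boltzmann S 1 (bondSpin spin ∘ ends) τ ≤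
      ∑ u ∈ D, ∑ τ, (spin o * spin u) τ * boltzmann S 1 (bondSpin spin ∘ ends) τ := by
  obtain ⟨u, huD, hu⟩ := hD
  have hposType : PosType (boltzmann S 1 (bondSpin spin ∘ ends)) :=
    boltzmann_posType fun _ _ => zero_le_one
  calc ∑ τ, boltzmann S 1 (bondSpin spin ∘ ends) τ
      = ∑ τ, (spin o * spin u) τ * boltzmann S 1 (bondSpin spin ∘ ends) τ := by
        simp only [hu.spin_mul_spin_mul_boltzmann_eq]
    _ ≤ _ := Finset.single_le_sum (f := fun u => ∑ τ, (spin o * spin u) τ * _)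
        (fun z _ => (hposType.char_mul (spin o * spin z)).sum_nonneg) huD

theorem sum_boltzmann_mul_sum_le (hJ : ∀ i ∈ S, 0 ≤ J i) (hv : PosType v)
    (h : (∃ u ∈ D, Linked ends S o u) ∨ ¬Linked ends S o x ∧ ∃ g : G,
      (∀ z, Linked ends S o z → spin z g = -1) ∧ (∀ z, ¬Linked ends S o z → spin z g = 1) ∧
        ∀ σ, v (g * σ) = v σ) :
    (∑ τ, boltzmann S 1 (bondSpin spin ∘ ends) τ) *
        ∑ σ, (spin o * spin x) σ * v σ * ∏ i ∈ S, J i * (J i + bondSpin spin (ends i) σ) ≤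
      (∑ u ∈ D, ∑ τ, (spin o * spin u) τ * boltzmann S 1 (bondSpin spin ∘ ends) τ) *
        ∑ σ, (spin o * spin x) σ * v σ * ∏ i ∈ S, J i * (J i + bondSpin spin (ends i) σ) := by
  rcases h with hD | ⟨hx, hflip⟩
  · have hbonds : PosType fun σ => ∏ i ∈ S, J i * (J i + bondSpin spin (ends i) σ) :=
      PosType.prod fun i hi => ((PosType.const (hJ i hi)).add (.char _)).smul _ (hJ i hi)
    exact mul_le_mul_of_nonneg_right (sum_boltzmann_le_sum_linked hD)
      ((hv.char_mul (spin o * spin x)).mul hbonds).sum_nonneg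
  · have hzero := sum_unlinked_eq_zero (J := J) hx hflip
    simp only [MonoidHom.mul_apply, hzero, mul_zero, le_refl]

/-- The Simon–Lieb inequality. The couplings in `F` join the region `I` only to `I ∪ D`, and the
factor `v` that collects all other couplings does not depend on the spins in `I`. -/
theorem simon_lieb (hJ : ∀ i ∈ F, J i ∈ Set.Icc 0 1) (hv : PosType v) (ho : o ∈ I) (hx : x ∉ I)
    (hF : ∀ i ∈ F, ∀ y z, ends i = s(y, z) → y ∈ I → z ∈ I ∨ z ∈ D)
    (hflip : ∀ C ⊆ I, ∃ g : G, (∀ z ∈ C, spin z g = -1) ∧ (∀ z ∉ C, spin z g = 1) ∧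
      ∀ σ, v (g * σ) = v σ) :
    (∑ σ, (spin o * spin x) σ * v σ * boltzmann F J (bondSpin spin ∘ ends) σ) *
        ∑ σ, boltzmann F J (bondSpin spin ∘ ends) σ ≤
      ∑ u ∈ D, (∑ σ, (spin o * spin u) σ * boltzmann F J (bondSpin spin ∘ ends) σ) *
        ∑ σ, (spin u * spin x) σ * v σ * boltzmann F J (bondSpin spin ∘ ends) σ := by
  classical
  set X := bondSpin spin ∘ ends
  have hleft := sum_char_mul_sum_boltzmann (F := F) (J := J) X 1 fun σ => (spin o * spin x) σ * v σ
  simp only [MonoidHom.one_apply, one_mul] at hleft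
  have hright : ∀ u, (∑ σ, (spin o * spin u) σ * boltzmann F J X σ) *
        ∑ σ, (spin u * spin x) σ * v σ * boltzmann F J X σ
      = ∑ S ∈ F.powerset, (∏ i ∈ F \ S, (1 - J i ^ 2)) *
        (∑ τ, (spin o * spin u) τ * boltzmann S 1 X τ) *
          ∑ σ, (spin o * spin x) σ * v σ * ∏ i ∈ S, J i * (J i + X i σ) := by
    intro u
    rw [← sum_char_mul_sum_boltzmann]
    refine congrArg _ (Finset.sum_congr rfl fun σ _ => ?_)
    simp only [MonoidHom.mul_apply]
    linear_combination (-(spin u σ * spin x σ * v σ * boltzmann F J X σ)) *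
      char_mul_self (spin o) σ
  simp only [hright]
  rw [mul_comm, hleft, Finset.sum_comm]
  refine Finset.sum_le_sum fun S hS => ?_
  have hSF := Finset.mem_powerset.1 hS
  have hfree : 0 ≤ ∏ i ∈ F \ S, (1 - J i ^ 2) := Finset.prod_nonneg fun i hi =>
    have hi := hJ i (Finset.mem_sdiff.1 hi).1
    sub_nonneg.2 (pow_le_one₀ hi.1 hi.2)
  rw [← Finset.sum_mul, ← Finset.mul_sum, mul_assoc, mul_assoc]
  refine mul_le_mul_of_nonneg_left (sum_boltzmann_mul_sum_le (fun i hi => (hJ i (hSF hi)).1) hv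
    (or_iff_not_imp_left.2 fun hD => ?_)) hfree
  have hI := setOf_linked_subset hSF hF ho fun u hu hou => hD ⟨u, hu, hou⟩
  exact ⟨fun h => hx (hI h), hflip _ hI⟩

end SimonLieb

section FiniteEnergy

variable {G ι : Type*} [Group G]

theorem one_add_mul_sum_char_le [Fintype G] {χ : G →* ℝ} {w : G → ℝ} {g : G} {δ : ℝ} (hχ : χ g = -1)
    (hw : ∀ σ, δ * w σ ≤ w (g * σ)) :
    (1 + δ) * ∑ σ, χ σ * w σ ≤ (1 - δ) * ∑ σ, w σ := by
  have hflip : ∑ σ, (1 - χ σ) * w σ = ∑ σ, (1 + χ σ) * w (g * σ) := by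
    rw [← Equiv.sum_comp (Equiv.mulLeft g)]
    simp only [Equiv.coe_mulLeft, map_mul, hχ, neg_mul, one_mul, sub_neg_eq_add]
  have hcost : ∑ σ, (1 + χ σ) * (δ * w σ) ≤ ∑ σ, (1 + χ σ) * w (g * σ) :=
    Finset.sum_le_sum fun σ _ => mul_le_mul_of_nonneg_left (hw σ) (by
      linarith [neg_le_of_abs_le (abs_char χ σ).le])
  rw [← hflip] at hcost
  have hsub : ∑ σ, (1 - χ σ) * w σ = ∑ σ, w σ - ∑ σ, χ σ * w σ := by
    simp only [sub_mul, one_mul, Finset.sum_sub_distrib]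
  have hadd : ∑ σ, (1 + χ σ) * (δ * w σ) = δ * ∑ σ, w σ + δ * ∑ σ, χ σ * w σ := by
    simp only [add_mul, one_mul, Finset.sum_add_distrib, Finset.mul_sum, mul_left_comm δ]
  linarith

theorem pow_card_mul_boltzmann_le [Finite G] {F : Finset ι} {χ : ι → G →* ℝ} {t : ℝ}
    (ht0 : 0 ≤ t) (ht1 : t < 1) (g σ : G) :
    ((1 - t) / (1 + t)) ^ (F.filter fun i => χ i g ≠ 1).card * boltzmann F (fun _ => t) χ σ ≤
      boltzmann F (fun _ => t) χ (g * σ) := by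
  have : 0 ≤ (1 - t) / (1 + t) := div_nonneg (by linarith) (by linarith)
  rw [← Finset.prod_const, Finset.prod_filter, boltzmann, ← Finset.prod_mul_distrib]
  refine Finset.prod_le_prod (fun i _ => ?_) fun i _ => ?_
  · have : 0 ≤ 1 + t * χ i σ := by nlinarith [neg_le_of_abs_le (abs_char (χ i) σ).le]
    split_ifs <;> positivity
  · split_ifs with h
    · calc (1 - t) / (1 + t) * (1 + t * χ i σ)
          ≤ (1 - t) / (1 + t) * (1 + t * 1) := by gcongr; exact char_le_one _ σ
        _ = 1 + t * -1 := by field_simp; ring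
        _ ≤ 1 + t * χ i (g * σ) := by
          gcongr; exact neg_le_of_abs_le (abs_char (χ i) (g * σ)).le
    · rw [map_mul, not_not.1 h, one_mul, one_mul]

end FiniteEnergy

/-! ### The Ising model on a cylinder -/

section Spin

variable {P : Type*}

open Classical in
/-- The spin at `x` of a configuration on `Λ`. The spins outside `Λ` are frozen to be `1`, so that
`spin Λ` also describes models with a pinned part. -/
def spin (Λ : Finset P) (x : P) : (Λ → ℤˣ) →* ℝ :=
  if h : x ∈ Λ then
    ((Int.castRingHom ℝ : ℤ →* ℝ).comp (Units.coeHom ℤ)).comp (Pi.evalMonoidHom _ ⟨x, h⟩)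
  else 1

variable {Λ : Finset P} {x : P}

theorem spin_of_mem (h : x ∈ Λ) (σ : Λ → ℤˣ) : spin Λ x σ = ((σ ⟨x, h⟩ : ℤˣ) : ℤ) := by
  simp [spin, h]

theorem spin_of_notMem (h : x ∉ Λ) : spin Λ x = 1 := by
  simp [spin, h]

theorem exists_spin_eq_ite {C : Set P} [DecidablePred (· ∈ C)] (hC : ∀ x ∈ C, x ∈ Λ) :
    ∃ g : Λ → ℤˣ, ∀ x, spin Λ x g = if x ∈ C then -1 else 1 := by
  refine ⟨fun z => if z.1 ∈ C then -1 else 1, fun x => ?_⟩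
  by_cases hx : x ∈ Λ
  · rw [spin_of_mem hx]
    split_ifs <;> simp
  · rw [spin_of_notMem hx, if_neg (mt (hC x) hx), MonoidHom.one_apply]

theorem exists_perm_spin (π : Equiv.Perm P) (hπ : ∀ x, x ∈ Λ ↔ π x ∈ Λ) :
    ∃ T : Equiv.Perm (Λ → ℤˣ), ∀ x σ, spin Λ x (T σ) = spin Λ (π x) σ := by
  refine ⟨Equiv.arrowCongr (π.subtypeEquiv hπ).symm (Equiv.refl _), fun x σ => ?_⟩
  by_cases hx : x ∈ Λ
  · rw [spin_of_mem hx, spin_of_mem ((hπ x).1 hx)]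
    simp
  · rw [spin_of_notMem hx, spin_of_notMem (mt (hπ x).2 hx), MonoidHom.one_apply,
      MonoidHom.one_apply]

theorem bondSpin_perm {π : Equiv.Perm P} {σ τ : Λ → ℤˣ} (h : ∀ x, spin Λ x τ = spin Λ (π x) σ)
    (z : Sym2 P) : bondSpin (spin Λ) z τ = bondSpin (spin Λ) (z.map π) σ := by
  induction z with
  | _ x y => simp only [Sym2.map_mk, bondSpin_mk, MonoidHom.mul_apply, h]

theorem sum_spin_mul_boltzmann_perm [DecidableEq P] (π : Equiv.Perm P)
    (hπ : ∀ x, x ∈ Λ ↔ π x ∈ Λ) {E : Finset (Sym2 P)} (hE : ∀ z ∈ E, z.map π ∈ E)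
    {K K' : Sym2 P → ℝ} (hK : ∀ z ∈ E, K z = K' (z.map π)) (x : P) :
    ∑ σ, spin Λ x σ * boltzmann E K (bondSpin (spin Λ)) σ =
      ∑ σ, spin Λ (π x) σ * boltzmann E K' (bondSpin (spin Λ)) σ := by
  obtain ⟨T, hT⟩ := exists_perm_spin π hπ
  have hinj : Set.InjOn (Sym2.map π) E := (Sym2.map.injective π.injective).injOn
  have himage : E.image (Sym2.map π) = E :=
    Finset.eq_of_subset_of_card_le (Finset.image_subset_iff.2 hE)
      (Finset.card_image_of_injOn hinj).ge
  rw [← Equiv.sum_comp T]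
  refine Finset.sum_congr rfl fun σ _ => ?_
  rw [hT, boltzmann, boltzmann]
  congr 1
  conv_rhs => rw [← himage, Finset.prod_image hinj]
  exact Finset.prod_congr rfl fun z hz => by rw [hK z hz, bondSpin_perm (hT · σ)]

end Spin

section Cylinder

variable {L : ℕ}

/-- The bond from `x` to its right neighbour in the discrete cylinder. -/
def horizontalBond (x : ZMod L × ℤ) : Sym2 (ZMod L × ℤ) := s(x, (x.1 + 1, x.2))

/-- The bond from `x` to its upper neighbour in the discrete cylinder. -/
def verticalBond (x : ZMod L × ℤ) : Sym2 (ZMod L × ℤ) := s(x, (x.1, x.2 + 1))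

theorem horizontalBond_injective (hL : 3 ≤ L) :
    Function.Injective (horizontalBond : ZMod L × ℤ → Sym2 (ZMod L × ℤ)) := by
  have htwo : ((2 : ℕ) : ZMod L) ≠ 0 := fun h =>
    absurd (Nat.le_of_dvd two_pos ((ZMod.natCast_eq_zero_iff 2 L).1 h)) (by omega)
  intro x y hxy
  obtain ⟨h, -⟩ | ⟨hx, hy⟩ := Sym2.eq_iff.1 hxy
  · exact h
  · refine absurd ?_ htwo
    have hx₁ : x.1 = y.1 + 1 := congrArg Prod.fst hx
    have hy₁ : x.1 + 1 = y.1 := congrArg Prod.fst hy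
    push_cast
    linear_combination hy₁ - hx₁

theorem verticalBond_ne_horizontalBond (x y : ZMod L × ℤ) :
    verticalBond x ≠ horizontalBond y := by
  intro h
  obtain ⟨h₁, h₂⟩ | ⟨h₁, h₂⟩ := Sym2.eq_iff.1 h <;>
  · have h₁' := congrArg Prod.snd h₁
    have h₂' := congrArg Prod.snd h₂
    dsimp only at h₁' h₂'
    omega

open Classical in
/-- The couplings `t`, with the sign reversed on the horizontal bonds that start in column `c` above
height `h`. This is the effect of a disorder line going up to the top of the cylinder. -/
def disorder (t : ℝ) (c : ZMod L) (h : ℤ) (z : Sym2 (ZMod L × ℤ)) : ℝ :=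
  if ∃ j > h, z = horizontalBond (c, j) then -t else t

theorem disorder_horizontalBond (hL : 3 ≤ L) (t : ℝ) (c k : ZMod L) (h j : ℤ) :
    disorder t c h (horizontalBond (k, j)) = if k = c ∧ h < j then -t else t := by
  have hiff : (∃ i > h, horizontalBond (k, j) = horizontalBond (c, i)) ↔ k = c ∧ h < j := by
    refine ⟨?_, fun ⟨hk, hj⟩ => ⟨j, hj, by rw [hk]⟩⟩
    rintro ⟨i, hi, heq⟩
    obtain ⟨rfl, rfl⟩ := Prod.mk.inj (horizontalBond_injective hL heq)
    exact ⟨rfl, hi⟩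
  simp only [disorder, hiff]

theorem disorder_verticalBond (t : ℝ) (c : ZMod L) (h : ℤ) (x : ZMod L × ℤ) :
    disorder t c h (verticalBond x) = t := by
  simp [disorder, verticalBond_ne_horizontalBond]

theorem abs_disorder (t : ℝ) (c : ZMod L) (h : ℤ) (z : Sym2 (ZMod L × ℤ)) :
    |disorder t c h z| = |t| := by
  unfold disorder
  split_ifs <;> simp

variable [NeZero L] {m : ℕ}

/-- The sites at heights `1, …, m` of the cylinder of circumference `L`. The spins at height `0` are
pinned to be `1`. -/
def cylSites (L m : ℕ) [NeZero L] : Finset (ZMod L × ℤ) := Finset.univ ×ˢ Finset.Icc 1 (m : ℤ)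

/-- The bonds of the cylinder with an end in `cylSites L m` and none above height `m`. -/
def cylBonds (L m : ℕ) [NeZero L] : Finset (Sym2 (ZMod L × ℤ)) :=
  (cylSites L m).image horizontalBond ∪ (Finset.univ ×ˢ Finset.Ico 0 (m : ℤ)).image verticalBond

theorem mem_cylSites {x : ZMod L × ℤ} : x ∈ cylSites L m ↔ 1 ≤ x.2 ∧ x.2 ≤ m := by
  simp [cylSites, Finset.mem_product]

theorem mem_cylBonds {z : Sym2 (ZMod L × ℤ)} :
    z ∈ cylBonds L m ↔ (∃ k, ∃ j : ℤ, 1 ≤ j ∧ j ≤ m ∧ horizontalBond (k, j) = z) ∨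
      ∃ k, ∃ j : ℤ, 0 ≤ j ∧ j < m ∧ verticalBond (k, j) = z := by
  simp [cylBonds, cylSites, and_assoc]

/-- The unnormalised correlation of the spin at `x` with a disorder line in column `c` that starts
above height `h`, in the cylinder with pinned bottom and free top. -/
def spinDisorder (L m : ℕ) [NeZero L] (t : ℝ) (c : ZMod L) (h : ℤ) (x : ZMod L × ℤ) : ℝ :=
  ∑ σ, spin (cylSites L m) x σ *
    boltzmann (cylBonds L m) (disorder t c h) (bondSpin (spin (cylSites L m))) σ

theorem spinDisorder_reflect (hL : 3 ≤ L) (t : ℝ) (c : ZMod L) (h j : ℤ) :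
    spinDisorder L m t c h (c + 1, j) = spinDisorder L m t c h (c, j) := by
  let π : Equiv.Perm (ZMod L × ℤ) := (Equiv.subLeft (2 * c + 1)).prodCongr (Equiv.refl ℤ)
  have hhor (k : ZMod L) (i : ℤ) :
      (horizontalBond (k, i)).map π = horizontalBond (2 * c - k, i) := by
    simp only [horizontalBond, Sym2.map_mk, Sym2.eq_iff]
    right
    constructor <;> ext <;> simp [π]
    ring
  have hver (k : ZMod L) (i : ℤ) :
      (verticalBond (k, i)).map π = verticalBond (2 * c + 1 - k, i) := rfl
  have hsite : π (c + 1, j) = (c, j) := by ext <;> simp [π]; ring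
  rw [← hsite]
  refine sum_spin_mul_boltzmann_perm π (fun x => by simp [π, mem_cylSites]) ?_ ?_ _
  · intro z hz
    obtain ⟨k, i, h₁, h₂, rfl⟩ | ⟨k, i, h₁, h₂, rfl⟩ := mem_cylBonds.1 hz
    · exact mem_cylBonds.2 (Or.inl ⟨_, i, h₁, h₂, (hhor k i).symm⟩)
    · exact mem_cylBonds.2 (Or.inr ⟨_, i, h₁, h₂, (hver k i).symm⟩)
  · intro z hz
    obtain ⟨k, i, -, -, rfl⟩ | ⟨k, i, -, -, rfl⟩ := mem_cylBonds.1 hz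
    · have hcol : 2 * c - k = c ↔ k = c := by
        constructor <;> intro hk <;> linear_combination -hk
      simp only [hhor, disorder_horizontalBond hL, hcol]
    · rw [hver, disorder_verticalBond, disorder_verticalBond]

theorem spinDisorder_rotate (hL : 3 ≤ L) (t : ℝ) (c : ZMod L) (h j : ℤ) :
    spinDisorder L m t (c + 1) h (c + 1, j) = spinDisorder L m t c h (c, j) := by
  let π : Equiv.Perm (ZMod L × ℤ) := (Equiv.addRight 1).prodCongr (Equiv.refl ℤ)
  have hhor (k : ZMod L) (i : ℤ) : (horizontalBond (k, i)).map π = horizontalBond (k + 1, i) := rfl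
  have hver (k : ZMod L) (i : ℤ) : (verticalBond (k, i)).map π = verticalBond (k + 1, i) := rfl
  refine (sum_spin_mul_boltzmann_perm π (fun x => by simp [π, mem_cylSites]) ?_ ?_ (c, j)).symm
  · intro z hz
    obtain ⟨k, i, h₁, h₂, rfl⟩ | ⟨k, i, h₁, h₂, rfl⟩ := mem_cylBonds.1 hz
    · exact mem_cylBonds.2 (Or.inl ⟨_, i, h₁, h₂, (hhor k i).symm⟩)
    · exact mem_cylBonds.2 (Or.inr ⟨_, i, h₁, h₂, (hver k i).symm⟩)
  · intro z hz
    obtain ⟨k, i, -, -, rfl⟩ | ⟨k, i, -, -, rfl⟩ := mem_cylBonds.1 hz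
    · simp only [hhor, disorder_horizontalBond hL, add_left_inj]
    · rw [hver, disorder_verticalBond, disorder_verticalBond]

theorem spinDisorder_horizontal (hL : 3 ≤ L) (t : ℝ) (c : ZMod L) {h : ℤ} (h1 : 1 ≤ h)
    (hm : h ≤ m) :
    (1 + t) * spinDisorder L m t c (h - 1) (c, h) = (1 - t) * spinDisorder L m t c h (c, h) := by
  have hmem : horizontalBond (c, h) ∈ cylBonds L m := mem_cylBonds.2 (Or.inl ⟨c, h, h1, hm, rfl⟩)
  have hJ : disorder t c h (horizontalBond (c, h)) = t := by simp [disorder_horizontalBond hL]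
  have hK : disorder t c (h - 1) (horizontalBond (c, h)) = -t := by
    simp [disorder_horizontalBond hL]
  have hagree : ∀ z ∈ cylBonds L m, z ≠ horizontalBond (c, h) →
      disorder t c (h - 1) z = disorder t c h z := by
    intro z hz hne
    obtain ⟨k, j, -, -, rfl⟩ | ⟨k, j, -, -, rfl⟩ := mem_cylBonds.1 hz
    · have hiff : (k = c ∧ h - 1 < j) ↔ k = c ∧ h < j := by
        refine and_congr_right fun hk => ?_
        have hj : j ≠ h := by rintro rfl; exact hne (by rw [hk])
        omega
      simp only [disorder_horizontalBond hL, hiff]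
    · rw [disorder_verticalBond, disorder_verticalBond]
  have hsum : spinDisorder L m t c (h - 1) (c, h) + t * spinDisorder L m t c (h - 1) (c + 1, h) =
      spinDisorder L m t c h (c, h) - t * spinDisorder L m t c h (c + 1, h) := by
    simp only [spinDisorder, Finset.mul_sum, ← Finset.sum_add_distrib, ← Finset.sum_sub_distrib]
    refine Finset.sum_congr rfl fun σ _ => ?_
    have hlocal := boltzmann_mul_of_eq_neg (χ := bondSpin (spin (cylSites L m))) hmem
      (hK.trans (congrArg Neg.neg hJ).symm) hagree σ
    rw [hJ, horizontalBond, bondSpin_mk, MonoidHom.mul_apply] at hlocal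
    have hsq := char_mul_self (spin (cylSites L m) (c, h)) σ
    linear_combination spin (cylSites L m) (c, h) σ * hlocal -
      t * spin (cylSites L m) (c + 1, h) σ *
        (boltzmann (cylBonds L m) (disorder t c (h - 1)) (bondSpin (spin (cylSites L m))) σ +
          boltzmann (cylBonds L m) (disorder t c h) (bondSpin (spin (cylSites L m))) σ) * hsq
  rw [spinDisorder_reflect hL, spinDisorder_reflect hL] at hsum
  linear_combination hsum

theorem disorder_mul_bondSpin_columnFlip (hL : 3 ≤ L) (t : ℝ) (c : ZMod L) {h : ℤ}
    {g : cylSites L m → ℤˣ}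
    (hg : ∀ x, spin (cylSites L m) x g = if x.1 = c + 1 ∧ h < x.2 ∧ x.2 ≤ m then -1 else 1)
    {z : Sym2 (ZMod L × ℤ)} (hz : z ∈ cylBonds L m) (hne : z ≠ verticalBond (c + 1, h)) :
    disorder t c h z * bondSpin (spin (cylSites L m)) z g = disorder t (c + 1) h z := by
  have : Fact (1 < L) := ⟨by omega⟩
  obtain ⟨k, j, -, hj, rfl⟩ | ⟨k, j, -, hj, rfl⟩ := mem_cylBonds.1 hz
  · rw [disorder_horizontalBond hL, disorder_horizontalBond hL]
    simp only [horizontalBond, bondSpin_mk, MonoidHom.mul_apply, hg, add_left_inj, hj, and_true]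
    by_cases hjh : h < j <;> by_cases hk : k = c <;> by_cases hk' : k = c + 1 <;> simp_all
  · rw [disorder_verticalBond, disorder_verticalBond]
    simp only [verticalBond, bondSpin_mk, MonoidHom.mul_apply, hg]
    have hiff : k = c + 1 ∧ h < j + 1 ∧ j + 1 ≤ (m : ℤ) ↔ k = c + 1 ∧ h < j ∧ j ≤ (m : ℤ) := by
      refine and_congr_right fun hk => ?_
      have hjh : j ≠ h := by rintro rfl; exact hne (by rw [hk])
      omega
    simp only [hiff]
    split_ifs <;> ring

theorem boltzmann_columnFlip (hL : 3 ≤ L) (t : ℝ) (c : ZMod L) {h : ℤ} (h0 : 0 ≤ h) (hm : h < m)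
    {g : cylSites L m → ℤˣ}
    (hg : ∀ x, spin (cylSites L m) x g = if x.1 = c + 1 ∧ h < x.2 ∧ x.2 ≤ m then -1 else 1)
    (σ : cylSites L m → ℤˣ) :
    boltzmann (cylBonds L m) (disorder t c h) (bondSpin (spin (cylSites L m))) (g * σ) *
        (1 + t * (spin (cylSites L m) (c + 1, h) σ * spin (cylSites L m) (c + 1, h + 1) σ)) =
      boltzmann (cylBonds L m) (disorder t (c + 1) h) (bondSpin (spin (cylSites L m))) σ *
        (1 - t * (spin (cylSites L m) (c + 1, h) σ * spin (cylSites L m) (c + 1, h + 1) σ)) := by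
  have hmem : verticalBond (c + 1, h) ∈ cylBonds L m :=
    mem_cylBonds.2 (Or.inr ⟨c + 1, h, h0, hm, rfl⟩)
  have hneg : disorder t c h (verticalBond (c + 1, h)) *
      bondSpin (spin (cylSites L m)) (verticalBond (c + 1, h)) g =
        -disorder t (c + 1) h (verticalBond (c + 1, h)) := by
    rw [disorder_verticalBond, disorder_verticalBond, verticalBond, bondSpin_mk,
      MonoidHom.mul_apply, hg, hg]
    simp [Int.add_one_le_of_lt hm]
  have hlocal := boltzmann_mul_of_eq_neg (χ := bondSpin (spin (cylSites L m))) hmem hneg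
    (fun z hz hne => disorder_mul_bondSpin_columnFlip hL t c hg hz hne) σ
  rwa [← boltzmann_mul_left, disorder_verticalBond] at hlocal

theorem spinDisorder_vertical (hL : 3 ≤ L) (t : ℝ) (c : ZMod L) {h : ℤ} (h0 : 0 ≤ h) (hm : h < m) :
    spinDisorder L m t c h (c, h + 1) = t * spinDisorder L m t c h (c, h) := by
  obtain ⟨g, hg⟩ := exists_spin_eq_ite (Λ := cylSites L m)
    (C := {x | x.1 = c + 1 ∧ h < x.2 ∧ x.2 ≤ m})
    fun x hx => mem_cylSites.2 ⟨Int.add_one_le_of_lt (h0.trans_lt hx.2.1), hx.2.2⟩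
  have hlow : spin (cylSites L m) (c + 1, h) g = 1 := by simp [hg]
  have hhigh : spin (cylSites L m) (c + 1, h + 1) g = -1 := by
    simp [hg, Int.add_one_le_of_lt hm]
  have hflip (x : ZMod L × ℤ) : spinDisorder L m t c h x = spin (cylSites L m) x g *
      ∑ σ, spin (cylSites L m) x σ *
        boltzmann (cylBonds L m) (disorder t c h) (bondSpin (spin (cylSites L m))) (g * σ) := by
    rw [spinDisorder, ← Equiv.sum_comp (Equiv.mulLeft g), Finset.mul_sum]
    exact Finset.sum_congr rfl fun σ _ => by rw [Equiv.coe_mulLeft, map_mul, mul_assoc]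
  have hsum : -spinDisorder L m t c h (c + 1, h + 1) + t * spinDisorder L m t c h (c + 1, h) =
      spinDisorder L m t (c + 1) h (c + 1, h + 1) -
        t * spinDisorder L m t (c + 1) h (c + 1, h) := by
    rw [hflip (c + 1, h + 1), hflip (c + 1, h), hlow, hhigh, neg_one_mul, neg_neg, one_mul]
    simp only [spinDisorder, Finset.mul_sum, ← Finset.sum_add_distrib, ← Finset.sum_sub_distrib]
    refine Finset.sum_congr rfl fun σ _ => ?_
    have hsq := char_mul_self (spin (cylSites L m) (c + 1, h + 1)) σ
    have hlocal := boltzmann_columnFlip hL t c h0 hm hg σ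
    linear_combination spin (cylSites L m) (c + 1, h + 1) σ * hlocal -
      t * spin (cylSites L m) (c + 1, h) σ *
        (boltzmann (cylBonds L m) (disorder t c h) (bondSpin (spin (cylSites L m))) (g * σ) +
          boltzmann (cylBonds L m) (disorder t (c + 1) h) (bondSpin (spin (cylSites L m))) σ) * hsq
  simp only [spinDisorder_reflect hL, spinDisorder_rotate hL] at hsum
  linarith

/-- The factor `t (1 + t) / (1 - t)` by which spin–disorder correlations decrease per unit of
height. It is less than `1` exactly when `t` is below the critical value `√2 - 1`. -/
def dualRatio (t : ℝ) : ℝ := t * ((1 + t) / (1 - t))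

theorem dualRatio_nonneg {t : ℝ} (ht0 : 0 ≤ t) (ht1 : t < 1) : 0 ≤ dualRatio t :=
  mul_nonneg ht0 (div_nonneg (by linarith) (by linarith))

theorem spinDisorder_eq_dualRatio_pow_mul (hL : 3 ≤ L) {t : ℝ} (ht1 : t < 1) (c : ZMod L) {h : ℕ}
    (hm : h ≤ m) :
    spinDisorder L m t c h (c, h) = dualRatio t ^ h * spinDisorder L m t c 0 (c, 0) := by
  induction h with
  | zero => simp
  | succ h ih =>
    have hne : 1 - t ≠ 0 := by linarith
    have hver := spinDisorder_vertical hL t c (Int.natCast_nonneg h) (Int.ofNat_lt.2 hm)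
    have hhor := spinDisorder_horizontal hL t c (h := h + 1) (m := m) (by omega) (by omega)
    rw [add_sub_cancel_right, hver, ih (by omega)] at hhor
    rw [Nat.cast_succ, pow_succ, dualRatio]
    field_simp
    rw [dualRatio] at hhor
    linear_combination -hhor

theorem cylinder_magnetization_le (hL : 3 ≤ L) {t : ℝ} (ht0 : 0 ≤ t) (ht1 : t < 1) (c : ZMod L) :
    ∑ σ, spin (cylSites L m) (c, m) σ *
        boltzmann (cylBonds L m) (fun _ => t) (bondSpin (spin (cylSites L m))) σ ≤
      dualRatio t ^ m *
        ∑ σ, boltzmann (cylBonds L m) (fun _ => t) (bondSpin (spin (cylSites L m))) σ := by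
  have hfree : ∀ z ∈ cylBonds L m, t = disorder t c m z := by
    intro z hz
    obtain ⟨k, j, -, hj, rfl⟩ | ⟨k, j, -, -, rfl⟩ := mem_cylBonds.1 hz
    · simp [disorder_horizontalBond hL, hj]
    · rw [disorder_verticalBond]
  have hpinned : spin (cylSites L m) (c, (0 : ℤ)) = 1 := spin_of_notMem (by simp [mem_cylSites])
  calc
    _ = spinDisorder L m t c m (c, m) :=
      Finset.sum_congr rfl fun σ _ => by rw [boltzmann_congr hfree]
    _ = dualRatio t ^ m * spinDisorder L m t c 0 (c, 0) :=
      spinDisorder_eq_dualRatio_pow_mul hL ht1 c le_rfl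
    _ ≤ _ := by
      refine mul_le_mul_of_nonneg_left ?_ (pow_nonneg (dualRatio_nonneg ht0 ht1) m)
      simp only [spinDisorder, hpinned, MonoidHom.one_apply, one_mul]
      exact sum_boltzmann_le_of_abs_le fun z _ =>
        (abs_disorder t c 0 z).trans_le (abs_of_nonneg ht0).le

end Cylinder

/-! ### Geometry of the square lattice -/

section Lattice

variable {x y z u : ℤ × ℤ}

/-- The supremum distance of two sites. -/
def supDist (x y : ℤ × ℤ) : ℕ := max (x.1 - y.1).natAbs (x.2 - y.2).natAbs

theorem squareLattice_adj_iff :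
    squareLattice.Adj x y ↔ (x.1 - y.1).natAbs + (x.2 - y.2).natAbs = 1 := by
  change |x.1 - y.1| + |x.2 - y.2| = 1 ↔ _
  rw [Int.abs_eq_natAbs, Int.abs_eq_natAbs]
  omega

theorem squareLattice_adj_cases (h : squareLattice.Adj x y) :
    y = (x.1 + 1, x.2) ∨ x = (y.1 + 1, y.2) ∨ y = (x.1, x.2 + 1) ∨ x = (y.1, y.2 + 1) := by
  rw [squareLattice_adj_iff] at h
  simp only [Prod.ext_iff]
  omega

theorem supDist_self (x : ℤ × ℤ) : supDist x x = 0 := by simp [supDist]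

theorem supDist_comm (x y : ℤ × ℤ) : supDist x y = supDist y x := by
  unfold supDist
  omega

theorem supDist_triangle (x y z : ℤ × ℤ) : supDist x z ≤ supDist x y + supDist y z := by
  unfold supDist
  omega

theorem eq_of_supDist_eq_zero (h : supDist x y = 0) : x = y := by
  unfold supDist at h
  ext <;> omega

theorem supDist_eq_one_of_adj (h : squareLattice.Adj x y) : supDist x y = 1 := by
  rw [squareLattice_adj_iff] at h
  unfold supDist
  omega

/-- The set of sites at supremum distance `m` from `y`. -/
def sphere (y : ℤ × ℤ) (m : ℕ) : Finset (ℤ × ℤ) := (Finset.box m).image (y + ·)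

theorem mem_sphere {m : ℕ} : u ∈ sphere y m ↔ supDist y u = m := by
  simp only [sphere, Finset.mem_image, Int.mem_box, supDist]
  constructor
  · rintro ⟨v, hv, rfl⟩
    simpa using hv
  · intro h
    refine ⟨u - y, ?_, add_sub_cancel y u⟩
    rw [Prod.fst_sub, Prod.snd_sub]
    omega

theorem card_sphere_le {m : ℕ} (hm : m ≠ 0) (y : ℤ × ℤ) : (sphere y m).card ≤ 8 * m :=
  Finset.card_image_le.trans_eq (Int.card_box hm)

theorem exists_isometry_of_mem_sphere {m : ℕ} (hu : u ∈ sphere y m) :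
    ∃ D : ℤ × ℤ → ℤ × ℤ, (∀ x z, supDist (D x) (D z) = supDist x z) ∧
      (∀ x z, squareLattice.Adj x z → squareLattice.Adj (D x) (D z)) ∧
      (D y).2 = 0 ∧ D u = (0, (m : ℤ)) := by
  rw [mem_sphere, supDist] at hu
  have hside : u.2 - y.2 = m ∨ y.2 - u.2 = m ∨ u.1 - y.1 = m ∨ y.1 - u.1 = m := by omega
  simp only [squareLattice_adj_iff, supDist]
  obtain h | h | h | h := hside
  · exact ⟨fun z => (z.1 - u.1, z.2 - y.2), by grind⟩
  · exact ⟨fun z => (z.1 - u.1, y.2 - z.2), by grind⟩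
  · exact ⟨fun z => (z.2 - u.2, z.1 - y.1), by grind⟩
  · exact ⟨fun z => (z.2 - u.2, y.1 - z.1), by grind⟩

theorem mem_edgesIn {Λ : Finset (ℤ × ℤ)} {e : squareLattice.edgeSet} :
    e ∈ edgesIn Λ ↔ ∀ z ∈ e.1, z ∈ Λ := by
  simp only [edgesIn, Finset.mem_subtype, Finset.mem_sym2_iff]

end Lattice

/-! ### Comparison of a box with a cylinder -/

section Pullback

variable {P P' : Type*}

open Classical in
/-- The configuration on `Λ` obtained by giving to `z` the spin at `D z` of a configuration on `Λ'`,
which is `1` when `D z` is not in `Λ'`. -/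
def pullback (Λ : Finset P) (Λ' : Finset P') (D : P → P') : (Λ' → ℤˣ) →* (Λ → ℤˣ) :=
  MonoidHom.mk' (fun σ z => if h : D z ∈ Λ' then σ ⟨_, h⟩ else 1) fun σ τ => by
    funext z
    simp only [Pi.mul_apply]
    split_ifs <;> simp

variable {Λ : Finset P} {Λ' : Finset P'} {D : P → P'}

theorem spin_comp_pullback {z : P} (hz : z ∈ Λ) :
    (spin Λ z).comp (pullback Λ Λ' D) = spin Λ' (D z) := by
  ext σ
  rw [MonoidHom.comp_apply, spin_of_mem hz]
  by_cases h : D z ∈ Λ'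
  · rw [spin_of_mem h]
    simp [pullback, h]
  · rw [spin_of_notMem h]
    simp [pullback, h]

theorem bondSpin_comp_pullback {z : Sym2 P} (hz : ∀ x ∈ z, x ∈ Λ) :
    (bondSpin (spin Λ) z).comp (pullback Λ Λ' D) = bondSpin (spin Λ') (z.map D) := by
  induction z with
  | _ x y =>
    rw [Sym2.map_mk, bondSpin_mk, bondSpin_mk, ← spin_comp_pullback (hz x (Sym2.mem_mk_left x y)),
      ← spin_comp_pullback (hz y (Sym2.mem_mk_right x y))]
    rfl

theorem bondSpin_eq_one {z : Sym2 P} (hz : ∀ x ∈ z, x ∉ Λ) : bondSpin (spin Λ) z = 1 := by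
  induction z with
  | _ x y =>
    rw [bondSpin_mk, spin_of_notMem (hz x (Sym2.mem_mk_left x y)),
      spin_of_notMem (hz y (Sym2.mem_mk_right x y)), one_mul]

theorem sum_spin_mul_spin_le_of_cylinder [DecidableEq P] {ι : Type*} {F : Finset ι}
    {ends : ι → Sym2 P} {L m : ℕ} [NeZero L] (hL : 3 ≤ L) {D : P → ZMod L × ℤ} {t : ℝ} (ht0 : 0 ≤ t)
    (ht1 : t < 1) (hF : ∀ i ∈ F, ∀ z ∈ ends i, z ∈ Λ)
    (hinj : Set.InjOn (fun i => (ends i).map D) F)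
    (hbond : ∀ i ∈ F, (ends i).map D ∈ cylBonds L m ∨ ∀ z ∈ ends i, D z ∉ cylSites L m)
    {y u : P} (hy : D y ∉ cylSites L m) {c : ZMod L} (hu : D u = (c, (m : ℤ))) (hyΛ : y ∈ Λ)
    (huΛ : u ∈ Λ) :
    ∑ σ, (spin Λ y * spin Λ u) σ * boltzmann F (fun _ => t) (bondSpin (spin Λ) ∘ ends) σ ≤
      dualRatio t ^ m * ∑ σ, boltzmann F (fun _ => t) (bondSpin (spin Λ) ∘ ends) σ := by
  have htmem : t ∈ Set.Icc (0 : ℝ) 1 := ⟨ht0, ht1.le⟩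
  have habs : |t| < 1 := by rwa [abs_of_nonneg ht0]
  have hpull (i : ι) (hi : i ∈ F) : ((bondSpin (spin Λ) ∘ ends) i).comp
      (pullback Λ (cylSites L m) D) = bondSpin (spin (cylSites L m)) ((ends i).map D) :=
    bondSpin_comp_pullback (hF i hi)
  have hobs (σ : cylSites L m → ℤˣ) : (spin Λ y * spin Λ u) (pullback Λ (cylSites L m) D σ) =
      spin (cylSites L m) (c, (m : ℤ)) σ := by
    have hy' := DFunLike.congr_fun (spin_comp_pullback (Λ' := cylSites L m) (D := D) hyΛ) σ
    have hu' := DFunLike.congr_fun (spin_comp_pullback (Λ' := cylSites L m) (D := D) huΛ) σ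
    rw [MonoidHom.comp_apply] at hy' hu'
    rw [MonoidHom.mul_apply, hy', hu', hu, spin_of_notMem hy, MonoidHom.one_apply, one_mul]
  have hcompare := correlation_le_of_contraction (pullback Λ (cylSites L m) D)
    (spin Λ y * spin Λ u) (E := cylBonds L m) (K := fun _ => t)
    (Y := bondSpin (spin (cylSites L m))) (fun _ _ => htmem) (fun _ _ => htmem) hinj
    (fun _ _ _ => le_rfl) (fun i hi _ => hpull i hi) fun i hi hout => by
      rw [hpull i hi]
      refine bondSpin_eq_one fun x hx => ?_
      obtain ⟨z, hz, rfl⟩ := Sym2.mem_map.1 hx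
      exact (hbond i hi).resolve_left hout z hz
  simp only [hobs] at hcompare
  have hZ : 0 < ∑ σ, boltzmann (cylBonds L m) (fun _ => t) (bondSpin (spin (cylSites L m))) σ :=
    Finset.sum_pos (fun σ _ => boltzmann_pos (fun _ _ => habs) σ) Finset.univ_nonempty
  have hZF : 0 ≤ ∑ σ, boltzmann F (fun _ => t) (bondSpin (spin Λ) ∘ ends) σ :=
    Finset.sum_nonneg fun σ _ => boltzmann_nonneg (fun _ _ => habs.le) σ
  refine le_of_mul_le_mul_right (hcompare.trans ?_) hZ
  refine (mul_le_mul_of_nonneg_right (cylinder_magnetization_le hL ht0 ht1 c) hZF).trans_eq ?_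
  ring

end Pullback

section Wrap

/-- The projection of the lattice onto the cylinder of circumference `L`. -/
def wrap (L : ℕ) (x : ℤ × ℤ) : ZMod L × ℤ := (x.1, x.2)

variable {L m : ℕ}

theorem eq_of_wrap_eq {x y : ℤ × ℤ} (h : supDist x y < L) (hxy : wrap L x = wrap L y) : x = y := by
  obtain ⟨h₁, h₂⟩ := Prod.mk.inj hxy
  have hdvd := (ZMod.intCast_eq_intCast_iff_dvd_sub _ _ _).1 h₁
  have hlt : |y.1 - x.1| < L := by
    rw [Int.abs_eq_natAbs]
    unfold supDist at h
    omega
  have hzero := Int.eq_zero_of_abs_lt_dvd hdvd hlt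
  ext
  · omega
  · exact h₂

theorem wrap_mem_cylBonds_or [NeZero L] {x y : ℤ × ℤ} (h : squareLattice.Adj x y) (hx : x.2 ≤ m)
    (hy : y.2 ≤ m) :
    s(wrap L x, wrap L y) ∈ cylBonds L m ∨ wrap L x ∉ cylSites L m ∧ wrap L y ∉ cylSites L m := by
  wlog hright : y = (x.1 + 1, x.2) ∨ y = (x.1, x.2 + 1) generalizing x y with hswap
  · rw [Sym2.eq_swap, and_comm]
    have hcases := squareLattice_adj_cases h
    exact hswap h.symm hy hx (by tauto)
  simp only [mem_cylBonds, mem_cylSites]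
  obtain rfl | rfl := hright
  · by_cases h1 : 1 ≤ x.2
    · exact Or.inl (Or.inl ⟨x.1, x.2, h1, hx, by simp [horizontalBond, wrap]⟩)
    · exact Or.inr (by simp only [wrap]; omega)
  · by_cases h0 : 0 ≤ x.2
    · exact Or.inl (Or.inr ⟨x.1, x.2, h0, by omega, by simp [verticalBond, wrap]⟩)
    · exact Or.inr (by simp only [wrap]; omega)

theorem sum_spin_mul_spin_le_of_mem_sphere {Λ : Finset (ℤ × ℤ)} {F : Finset squareLattice.edgeSet}
    {y u : ℤ × ℤ} {t : ℝ} (hm : m ≠ 0) (ht0 : 0 ≤ t) (ht1 : t < 1)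
    (hF : ∀ e ∈ F, ∀ z ∈ e.1, z ∈ Λ ∧ supDist y z ≤ m) (hyΛ : y ∈ Λ) (huΛ : u ∈ Λ)
    (hu : u ∈ sphere y m) :
    ∑ σ, (spin Λ y * spin Λ u) σ * boltzmann F (fun _ => t) (bondSpin (spin Λ) ∘ Subtype.val) σ ≤
      dualRatio t ^ m *
        ∑ σ, boltzmann F (fun _ => t) (bondSpin (spin Λ) ∘ Subtype.val) σ := by
  obtain ⟨D, hdist, hadj, hDy, hDu⟩ := exists_isometry_of_mem_sphere hu
  have hinj {x z : ℤ × ℤ} (hx : supDist y x ≤ m) (hz : supDist y z ≤ m)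
      (hxz : wrap (2 * m + 1) (D x) = wrap (2 * m + 1) (D z)) : x = z := by
    have hlt : supDist (D x) (D z) < 2 * m + 1 := by
      have := supDist_triangle x y z
      rw [supDist_comm x y] at this
      rw [hdist]
      omega
    exact eq_of_supDist_eq_zero (by rw [← hdist, eq_of_wrap_eq hlt hxz, supDist_self])
  have hheight {z : ℤ × ℤ} (hz : supDist y z ≤ m) : (D z).2 ≤ m := by
    rw [← hdist, supDist] at hz
    omega
  refine sum_spin_mul_spin_le_of_cylinder (L := 2 * m + 1) (D := wrap (2 * m + 1) ∘ D) (c := 0)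
    (by omega) ht0 ht1 (fun e he z hz => (hF e he z hz).1) ?_ ?_ ?_ ?_ hyΛ huΛ
  · intro e he e' he' heq
    refine Subtype.ext (Sym2.ext fun z => ?_)
    have hmap (w : ZMod (2 * m + 1) × ℤ) := congrArg (w ∈ ·) heq
    simp only [Sym2.mem_map, eq_iff_iff] at hmap
    constructor
    · intro hz
      obtain ⟨z', hz', heq'⟩ := (hmap _).1 ⟨z, hz, rfl⟩
      rwa [← hinj (hF e' he' z' hz').2 (hF e he z hz).2 heq']
    · intro hz
      obtain ⟨z', hz', heq'⟩ := (hmap _).2 ⟨z, hz, rfl⟩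
      rwa [← hinj (hF e he z' hz').2 (hF e' he' z hz).2 heq']
  · rintro ⟨⟨x, z⟩, hxz⟩ he
    have hends := hF _ he
    have := wrap_mem_cylBonds_or (L := 2 * m + 1) (hadj x z hxz)
      (hheight (hends x (Sym2.mem_mk_left x z)).2) (hheight (hends z (Sym2.mem_mk_right x z)).2)
    exact this.imp_right fun h => Sym2.ball.2 h
  · simp [mem_cylSites, wrap, hDy]
  · simp [wrap, hDu]

end Wrap

section Neighbors

variable {y z : ℤ × ℤ} {Λ : Finset (ℤ × ℤ)}

/-- The set of the four neighbours of a site. -/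
def neighbors (y : ℤ × ℤ) : Finset (ℤ × ℤ) :=
  {(y.1 + 1, y.2), (y.1 - 1, y.2), (y.1, y.2 + 1), (y.1, y.2 - 1)}

theorem mem_neighbors : z ∈ neighbors y ↔ squareLattice.Adj y z := by
  simp only [neighbors, Finset.mem_insert, Finset.mem_singleton, squareLattice_adj_iff,
    Prod.ext_iff]
  omega

theorem card_neighbors (y : ℤ × ℤ) : (neighbors y).card = 4 := by
  rw [neighbors, Finset.card_insert_of_notMem, Finset.card_insert_of_notMem,
    Finset.card_insert_of_notMem, Finset.card_singleton] <;> simp <;> omega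

theorem notMem_boundary (h : ∀ z, squareLattice.Adj y z → z ∈ Λ) : y ∉ boundary Λ := by
  classical
  simp only [boundary, Finset.mem_filter, not_and, not_lt]
  intro _
  rw [← card_neighbors y]
  refine Finset.card_le_card fun z hz => ?_
  rw [mem_neighbors] at hz
  exact Finset.mem_filter.2 ⟨h z hz, hz⟩

theorem notMem_boundary_of_supDist_lt {m : ℕ} (hΛ : ∀ w, supDist y w ≤ m → w ∈ Λ)
    (hz : supDist y z < m) : z ∉ boundary Λ :=
  notMem_boundary fun w hw => hΛ w <| by
    have := supDist_triangle y z w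
    have := supDist_eq_one_of_adj hw
    omega

theorem card_filter_incident_le (F : Finset squareLattice.edgeSet) (y : ℤ × ℤ) :
    (F.filter fun e => y ∈ e.1).card ≤ 4 := by
  classical
  rw [← card_neighbors y]
  refine le_trans ?_ (Finset.card_image_le (f := fun z => s(y, z)))
  refine Finset.card_le_card_of_injOn Subtype.val (fun e he => ?_) Subtype.val_injective.injOn
  obtain ⟨z, hz⟩ := (Finset.mem_filter.1 he).2
  have hadj : squareLattice.Adj y z := (SimpleGraph.mem_edgeSet _).1 (hz ▸ e.2)
  exact Finset.mem_image.2 ⟨z, mem_neighbors.2 hadj, hz.symm⟩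

end Neighbors

/-! ### The Ising model with a boundary condition -/

section Ising

open Classical in
/-- The pairs of boundary sites that a boundary condition forces to have equal spins. -/
def wiredPairs (Λ : Finset (ℤ × ℤ)) (ξ : BoundaryCondition Λ) :
    Finset (boundary Λ × boundary Λ) :=
  Finset.univ.filter fun q => ξ q.1 q.2

theorem mem_wiredPairs {Λ : Finset (ℤ × ℤ)} {ξ : BoundaryCondition Λ}
    {q : boundary Λ × boundary Λ} : q ∈ wiredPairs Λ ξ ↔ ξ q.1 q.2 := by
  simp only [wiredPairs, Finset.mem_filter, Finset.mem_univ, true_and]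

/-- The constraint that the spins are constant on the classes of a boundary condition, as a Gibbs
weight with infinite couplings. -/
def bcWeight (Λ : Finset (ℤ × ℤ)) (ξ : BoundaryCondition Λ) : (Λ → ℤˣ) → ℝ :=
  boltzmann (wiredPairs Λ ξ) 1 fun q => spin Λ q.1 * spin Λ q.2

/-- The weight of the ferromagnetic Ising model on `Λ` with boundary condition `ξ`, where `t` is the
hyperbolic tangent of the coupling. -/
def isingWeight (t : ℝ) (Λ : Finset (ℤ × ℤ)) (ξ : BoundaryCondition Λ) (σ : Λ → ℤˣ) : ℝ :=
  boltzmann (edgesIn Λ) (fun _ => t) (bondSpin (spin Λ) ∘ Subtype.val) σ * bcWeight Λ ξ σ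

/-- The two-point function of the Ising model. -/
def twoPoint (t : ℝ) (Λ : Finset (ℤ × ℤ)) (ξ : BoundaryCondition Λ) (x y : ℤ × ℤ) : ℝ :=
  (∑ σ, (spin Λ x * spin Λ y) σ * isingWeight t Λ ξ σ) / ∑ σ, isingWeight t Λ ξ σ

variable {t : ℝ} {Λ : Finset (ℤ × ℤ)} {ξ : BoundaryCondition Λ} {x y o : ℤ × ℤ}

theorem bcWeight_posType : PosType (bcWeight Λ ξ) :=
  boltzmann_posType fun _ _ => zero_le_one

theorem bcWeight_nonneg (σ : Λ → ℤˣ) : 0 ≤ bcWeight Λ ξ σ :=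
  boltzmann_nonneg (fun _ _ => abs_one.le) σ

theorem bcWeight_mul {g : Λ → ℤˣ} (hg : ∀ z ∈ boundary Λ, spin Λ z g = 1) (σ : Λ → ℤˣ) :
    bcWeight Λ ξ (g * σ) = bcWeight Λ ξ σ :=
  boltzmann_mul_of_char_eq_one (fun q _ => by
    rw [MonoidHom.mul_apply, hg _ q.1.2, hg _ q.2.2, one_mul]) σ

theorem isingWeight_nonneg (ht0 : 0 ≤ t) (ht1 : t ≤ 1) (σ : Λ → ℤˣ) : 0 ≤ isingWeight t Λ ξ σ :=
  mul_nonneg (boltzmann_nonneg (fun _ _ => by rwa [abs_of_nonneg ht0]) σ) (bcWeight_nonneg σ)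

theorem sum_isingWeight_pos (ht0 : 0 ≤ t) (ht1 : t ≤ 1) : 0 < ∑ σ, isingWeight t Λ ξ σ := by
  refine Finset.sum_pos' (fun σ _ => isingWeight_nonneg ht0 ht1 σ) ⟨1, Finset.mem_univ _, ?_⟩
  rw [isingWeight, bcWeight, boltzmann_one, boltzmann_one]
  refine mul_pos (Finset.prod_pos fun _ _ => by linarith) (Finset.prod_pos fun _ _ => ?_)
  exact add_pos one_pos one_pos

theorem sum_spin_mul_isingWeight_nonneg (ht : 0 ≤ t) (x y : ℤ × ℤ) :
    0 ≤ ∑ σ, (spin Λ x * spin Λ y) σ * isingWeight t Λ ξ σ :=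
  (((boltzmann_posType fun _ _ => ht).mul bcWeight_posType).char_mul
    (spin Λ x * spin Λ y)).sum_nonneg

theorem twoPoint_le_one (ht0 : 0 ≤ t) (ht1 : t ≤ 1) (x y : ℤ × ℤ) : twoPoint t Λ ξ x y ≤ 1 :=
  div_le_one_of_le₀ (Finset.sum_le_sum fun σ _ => mul_le_of_le_one_left
    (isingWeight_nonneg ht0 ht1 σ) (char_le_one (spin Λ x * spin Λ y) σ))
    (sum_isingWeight_pos ht0 ht1).le

open Classical in
/-- The edges of `Λ` with at least one end in `I`. -/
def edgesMeeting (Λ : Finset (ℤ × ℤ)) (I : Set (ℤ × ℤ)) : Finset squareLattice.edgeSet :=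
  (edgesIn Λ).filter fun e => ∃ z ∈ e.1, z ∈ I

theorem mem_edgesMeeting {I : Set (ℤ × ℤ)} {e : squareLattice.edgeSet} :
    e ∈ edgesMeeting Λ I ↔ e ∈ edgesIn Λ ∧ ∃ z ∈ e.1, z ∈ I := by
  simp only [edgesMeeting, Finset.mem_filter]

theorem bondSpin_eq_one_of_forall {P : Type*} {Λ : Finset P} {g : Λ → ℤˣ} {z : Sym2 P}
    (h : ∀ x ∈ z, spin Λ x g = 1) : bondSpin (spin Λ) z g = 1 := by
  induction z with
  | _ x y =>
    rw [bondSpin_mk, MonoidHom.mul_apply, h x (Sym2.mem_mk_left x y),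
      h y (Sym2.mem_mk_right x y), one_mul]

theorem simon_lieb_isingWeight (ht : t ∈ Set.Icc (0 : ℝ) 1) {I : Set (ℤ × ℤ)}
    {D : Finset (ℤ × ℤ)} (hI : ∀ z ∈ I, z ∈ Λ ∧ z ∉ boundary Λ)
    (hD : ∀ z ∈ I, ∀ w, squareLattice.Adj z w → w ∈ I ∨ w ∈ D) (ho : o ∈ I) (hx : x ∉ I) :
    (∑ σ, (spin Λ o * spin Λ x) σ * isingWeight t Λ ξ σ) *
        ∑ σ, boltzmann (edgesMeeting Λ I) (fun _ => t) (bondSpin (spin Λ) ∘ Subtype.val) σ ≤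
      ∑ u ∈ D, (∑ σ, (spin Λ o * spin Λ u) σ *
          boltzmann (edgesMeeting Λ I) (fun _ => t) (bondSpin (spin Λ) ∘ Subtype.val) σ) *
        ∑ σ, (spin Λ u * spin Λ x) σ * isingWeight t Λ ξ σ := by
  classical
  set E := (edgesIn Λ).filter fun e => ¬∃ z ∈ e.1, z ∈ I
  set v : (Λ → ℤˣ) → ℝ := fun σ =>
    boltzmann E (fun _ => t) (bondSpin (spin Λ) ∘ Subtype.val) σ * bcWeight Λ ξ σ with hv
  have hsplit (σ : Λ → ℤˣ) : isingWeight t Λ ξ σ =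
      v σ * boltzmann (edgesMeeting Λ I) (fun _ => t) (bondSpin (spin Λ) ∘ Subtype.val) σ := by
    simp only [isingWeight, hv, boltzmann, edgesMeeting, E]
    rw [← Finset.prod_filter_mul_prod_filter_not (edgesIn Λ) fun e => ∃ z ∈ e.1, z ∈ I]
    ring
  simp only [hsplit, ← mul_assoc]
  refine simon_lieb (fun _ _ => ht) ((boltzmann_posType fun _ _ => ht.1).mul bcWeight_posType)
    ho hx (fun e _ y z hyz hy => hD y hy z ((SimpleGraph.mem_edgeSet _).1 (hyz ▸ e.2)))
    fun C hC => ?_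
  obtain ⟨g, hg⟩ := exists_spin_eq_ite fun z hz => (hI z (hC hz)).1
  have hone {z : ℤ × ℤ} (hz : z ∉ I) : spin Λ z g = 1 := by rw [hg, if_neg fun h => hz (hC h)]
  refine ⟨g, fun z hz => by rw [hg, if_pos hz], fun z hz => by rw [hg, if_neg hz], fun σ => ?_⟩
  simp only [hv]
  rw [bcWeight_mul fun z hz => hone fun h => (hI z h).2 hz, boltzmann_mul_of_char_eq_one]
  exact fun e he => bondSpin_eq_one_of_forall fun z hz =>
    hone fun h => (Finset.mem_filter.1 he).2 ⟨z, hz, h⟩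

theorem twoPoint_le_mul_sum (ht0 : 0 ≤ t) (ht1 : t < 1) {I : Set (ℤ × ℤ)} {D : Finset (ℤ × ℤ)}
    (hI : ∀ z ∈ I, z ∈ Λ ∧ z ∉ boundary Λ)
    (hD : ∀ z ∈ I, ∀ w, squareLattice.Adj z w → w ∈ I ∨ w ∈ D) (ho : o ∈ I) (hx : x ∉ I) {c : ℝ}
    (hc : ∀ u ∈ D, ∑ σ, (spin Λ o * spin Λ u) σ *
        boltzmann (edgesMeeting Λ I) (fun _ => t) (bondSpin (spin Λ) ∘ Subtype.val) σ ≤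
      c * ∑ σ, boltzmann (edgesMeeting Λ I) (fun _ => t) (bondSpin (spin Λ) ∘ Subtype.val) σ) :
    twoPoint t Λ ξ o x ≤ c * ∑ u ∈ D, twoPoint t Λ ξ u x := by
  have hfree : 0 < ∑ σ, boltzmann (edgesMeeting Λ I) (fun _ => t)
      (bondSpin (spin Λ) ∘ Subtype.val) σ :=
    Finset.sum_pos (fun σ _ => boltzmann_pos (fun _ _ => by rwa [abs_of_nonneg ht0]) σ)
      Finset.univ_nonempty
  simp only [twoPoint]
  rw [← Finset.sum_div, ← mul_div_assoc]
  refine div_le_div_of_nonneg_right ?_ (sum_isingWeight_pos ht0 ht1.le).le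
  refine le_of_mul_le_mul_right ((simon_lieb_isingWeight ⟨ht0, ht1.le⟩ hI hD ho hx).trans ?_) hfree
  rw [mul_right_comm, Finset.mul_sum]
  exact Finset.sum_le_sum fun u hu =>
    mul_le_mul_of_nonneg_right (hc u hu) (sum_spin_mul_isingWeight_nonneg ht0 u x)

theorem twoPoint_le_sum_sphere (ht0 : 0 ≤ t) (ht1 : t < 1) {m : ℕ} (hm : m ≠ 0)
    (hΛ : ∀ z, supDist y z ≤ m → z ∈ Λ) (hx : m ≤ supDist y x) :
    twoPoint t Λ ξ y x ≤ dualRatio t ^ m * ∑ u ∈ sphere y m, twoPoint t Λ ξ u x := by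
  have hadj {z w : ℤ × ℤ} (h : squareLattice.Adj z w) : supDist y w ≤ supDist y z + 1 :=
    (supDist_triangle y z w).trans_eq (by rw [supDist_eq_one_of_adj h])
  refine twoPoint_le_mul_sum ht0 ht1 (I := {z | supDist y z < m})
    (fun z hz => ⟨hΛ z (le_of_lt hz), notMem_boundary_of_supDist_lt hΛ hz⟩)
    (fun z hz w hw => ?_) ?_ (not_lt.2 hx) fun u hu => ?_
  · rw [mem_sphere, Set.mem_ofPred_eq, ← le_iff_lt_or_eq]
    exact (hadj hw).trans hz
  · rw [Set.mem_ofPred_eq, supDist_self]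
    exact Nat.pos_of_ne_zero hm
  · refine sum_spin_mul_spin_le_of_mem_sphere hm ht0 ht1 (fun e he z hz => ?_)
      (hΛ y (by rw [supDist_self]; exact m.zero_le)) (hΛ u (mem_sphere.1 hu).le) hu
    obtain ⟨heΛ, w, hw, hwI⟩ := mem_edgesMeeting.1 he
    refine ⟨mem_edgesIn.1 heΛ z hz, ?_⟩
    obtain rfl | hwz := eq_or_ne w z
    · exact le_of_lt hwI
    · have hends := (Sym2.mem_and_mem_iff hwz).1 ⟨hw, hz⟩
      exact (hadj ((SimpleGraph.mem_edgeSet _).1 (hends ▸ e.2))).trans hwI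

theorem pow_four_mul_isingWeight_le (ht0 : 0 ≤ t) (ht1 : t < 1) (hyb : y ∉ boundary Λ)
    {g : Λ → ℤˣ} (hg : ∀ z, z ≠ y → spin Λ z g = 1) (σ : Λ → ℤˣ) :
    ((1 - t) / (1 + t)) ^ 4 * isingWeight t Λ ξ σ ≤ isingWeight t Λ ξ (g * σ) := by
  classical
  have hρ0 : 0 ≤ (1 - t) / (1 + t) := div_nonneg (by linarith) (by linarith)
  have hρ1 : (1 - t) / (1 + t) ≤ 1 := div_le_one_of_le₀ (by linarith) (by linarith)
  have hcard :
      ((edgesIn Λ).filter fun e => (bondSpin (spin Λ) ∘ Subtype.val) e g ≠ 1).card ≤ 4 := by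
    refine (Finset.card_le_card fun e he => ?_).trans (card_filter_incident_le (edgesIn Λ) y)
    obtain ⟨heΛ, hne⟩ := Finset.mem_filter.1 he
    refine Finset.mem_filter.2 ⟨heΛ, by_contra fun hy => hne ?_⟩
    exact bondSpin_eq_one_of_forall fun z hz => hg z fun hzy => hy (hzy ▸ hz)
  rw [isingWeight, isingWeight, bcWeight_mul fun z hz => hg z (ne_of_mem_of_not_mem hz hyb),
    ← mul_assoc]
  refine mul_le_mul_of_nonneg_right ?_ (bcWeight_nonneg σ)
  refine le_trans ?_ (pow_card_mul_boltzmann_le ht0 ht1 g σ)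
  exact mul_le_mul_of_nonneg_right (pow_le_pow_of_le_one hρ0 hρ1 hcard)
    (boltzmann_nonneg (fun _ _ => by rw [abs_of_nonneg ht0]; exact ht1.le) σ)

theorem twoPoint_le_of_ne (ht0 : 0 ≤ t) (ht1 : t < 1) (hxy : x ≠ y) (hy : y ∈ Λ)
    (hyb : y ∉ boundary Λ) :
    twoPoint t Λ ξ y x ≤
      (1 - ((1 - t) / (1 + t)) ^ 4) / (1 + ((1 - t) / (1 + t)) ^ 4) := by
  classical
  obtain ⟨g, hg⟩ := exists_spin_eq_ite (C := {y}) (Λ := Λ) (by simpa using hy)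
  have hχ : (spin Λ y * spin Λ x) g = -1 := by
    simp [hg, hxy]
  have hflip := one_add_mul_sum_char_le hχ (pow_four_mul_isingWeight_le (ξ := ξ) ht0 ht1 hyb
    fun z hz => by simp [hg, hz])
  rw [twoPoint, div_le_div_iff₀ (sum_isingWeight_pos ht0 ht1.le) (by positivity), mul_comm]
  exact hflip

end Ising

/-! ### The Edwards–Sokal coupling -/

section EdwardsSokal

theorem card_forall_adj_eq {V α : Type*} [Finite V] (H : SimpleGraph V) :
    Nat.card {f : V → α // ∀ x y, H.Adj x y → f x = f y} =
      Nat.card α ^ Nat.card H.ConnectedComponent := by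
  have hreach {f : V → α} (hf : ∀ x y, H.Adj x y → f x = f y) (x y : V) (h : H.Reachable x y) :
      f x = f y := by
    rw [SimpleGraph.reachable_iff_reflTransGen] at h
    induction h with
    | refl => rfl
    | tail _ hadj ih => exact ih.trans (hf _ _ hadj)
  let e : {f : V → α // ∀ x y, H.Adj x y → f x = f y} ≃ (H.ConnectedComponent → α) :=
    { toFun := fun f => Quot.lift f.1 (hreach f.2)
      invFun := fun φ => ⟨fun x => φ (H.connectedComponentMk x), fun x y h =>
        congrArg φ (SimpleGraph.ConnectedComponent.eq.2 h.reachable)⟩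
      left_inv := fun f => rfl
      right_inv := fun φ => by
        funext c
        induction c using SimpleGraph.ConnectedComponent.ind
        rfl }
  rw [Nat.card_congr e, Nat.card_fun]

section Weights

variable {G ι : Type*} [Group G] {χ : ι → G →* ℝ} {F S : Finset ι}

open Classical in
theorem boltzmann_one_eq_ite [Finite G] (σ : G) :
    boltzmann S 1 χ σ = if ∀ i ∈ S, χ i σ = 1 then 2 ^ S.card else 0 := by
  simp only [boltzmann, Pi.one_apply, one_mul]
  split_ifs with h
  · rw [← Finset.prod_const]
    exact Finset.prod_congr rfl fun i hi => by rw [h i hi, one_add_one_eq_two]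
  · push Not at h
    obtain ⟨i, hi, hne⟩ := h
    have hneg := (mul_self_eq_one_iff.1 (char_mul_self (χ i) σ)).resolve_left hne
    exact Finset.prod_eq_zero hi (by rw [hneg, add_neg_cancel])

theorem sum_powerset_mul_boltzmann_one {a b : ℝ} (hab : a + b ≠ 0) (σ : G) :
    ∑ S ∈ F.powerset, a ^ S.card * b ^ (F.card - S.card) * boltzmann S 1 χ σ =
      (a + b) ^ F.card * boltzmann F (fun _ => a / (a + b)) χ σ := by
  classical
  have hfactor (i : ι) :
      (a + b) * (1 + a / (a + b) * χ i σ) = a * (1 + χ i σ) + b := by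
    field_simp
    ring
  rw [← Finset.prod_const, boltzmann, ← Finset.prod_mul_distrib]
  simp only [hfactor, Finset.prod_add, Finset.prod_mul_distrib, Finset.prod_const, boltzmann,
    Pi.one_apply, one_mul]
  refine Finset.sum_congr rfl fun S hS => ?_
  rw [Finset.card_sdiff_of_subset (Finset.mem_powerset.1 hS)]
  ring

end Weights

variable {Λ : Finset (ℤ × ℤ)} {ξ : BoundaryCondition Λ} {S : Finset squareLattice.edgeSet}
  {x y : ℤ × ℤ} {p q : ℝ}

theorem openGraph_ofOpenEdges_adj : (openGraph (ofOpenEdges S)).Adj x y ↔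
    ∃ h : s(x, y) ∈ squareLattice.edgeSet, ⟨s(x, y), h⟩ ∈ S := by
  simp only [openGraph, SimpleGraph.fromEdgeSet_adj, ofOpenEdges, decide_eq_true_eq,
    Set.mem_ofPred_eq, and_iff_left_iff_imp]
  rintro ⟨h, -⟩
  exact ((SimpleGraph.mem_edgeSet _).1 h).ne

theorem linked_of_connected (h : Connected (ofOpenEdges S) x y) : Linked Subtype.val S x y := by
  refine Relation.ReflTransGen.mono (fun a b hab => ?_) _ _
    ((SimpleGraph.reachable_iff_reflTransGen x y).1 h)
  obtain ⟨he, heS⟩ := openGraph_ofOpenEdges_adj.1 hab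
  exact ⟨_, heS, rfl⟩

theorem spin_mul_spin_eq_one_iff {P : Type*} {Λ : Finset P} {σ : Λ → ℤˣ} {x y : Λ} :
    (spin Λ x * spin Λ y) σ = 1 ↔ σ x = σ y := by
  rw [MonoidHom.mul_apply, spin_of_mem x.2, spin_of_mem y.2]
  norm_cast
  rw [Units.val_eq_one, mul_eq_one_iff_eq_inv, Int.units_inv_eq_self]

theorem forall_wiredGraph_adj_iff (hS : S ⊆ edgesIn Λ) {σ : Λ → ℤˣ} :
    (∀ x y, (wiredGraph Λ ξ S).Adj x y → σ x = σ y) ↔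
      (∀ e ∈ S, (bondSpin (spin Λ) ∘ Subtype.val) e σ = 1) ∧
        ∀ q ∈ wiredPairs Λ ξ, (spin Λ q.1 * spin Λ q.2) σ = 1 := by
  have hΛ {x : ℤ × ℤ} (hx : x ∈ boundary Λ) : x ∈ Λ := (Finset.mem_filter.1 hx).1
  constructor
  · refine fun h => ⟨?_, ?_⟩
    · rintro ⟨⟨x, y⟩, hxy⟩ he
      have hends := mem_edgesIn.1 (hS he)
      exact spin_mul_spin_eq_one_iff.2 (h ⟨x, hends x (Sym2.mem_mk_left x y)⟩
        ⟨y, hends y (Sym2.mem_mk_right x y)⟩ (Or.inl (openGraph_ofOpenEdges_adj.2 ⟨hxy, he⟩)))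
    · rintro ⟨⟨x, hx⟩, y, hy⟩ hq
      have hξ := mem_wiredPairs.1 hq
      refine spin_mul_spin_eq_one_iff (x := ⟨x, hΛ hx⟩) (y := ⟨y, hΛ hy⟩).2 ?_
      obtain rfl | hne := eq_or_ne x y
      · rfl
      · exact h _ _ (Or.inr ((SimpleGraph.fromRel_adj _ _ _).2
          ⟨fun h => hne (congrArg Subtype.val h), Or.inl ⟨hx, hy, hξ⟩⟩))
  · rintro ⟨hbond, hwired⟩ x y (hadj | hadj)
    · obtain ⟨he, heS⟩ := openGraph_ofOpenEdges_adj.1 hadj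
      exact spin_mul_spin_eq_one_iff.1 (hbond _ heS)
    · have hξ {x y : Λ} (h : ∃ (hx : x.1 ∈ boundary Λ) (hy : y.1 ∈ boundary Λ),
          ξ ⟨x.1, hx⟩ ⟨y.1, hy⟩) : σ x = σ y := by
        obtain ⟨hx, hy, h⟩ := h
        exact spin_mul_spin_eq_one_iff.1
          (hwired (⟨x, hx⟩, ⟨y, hy⟩) (mem_wiredPairs.2 h))
      exact ((SimpleGraph.fromRel_adj _ _ _).1 hadj).2.elim hξ fun h => (hξ h).symm

theorem sum_boltzmann_one_mul_bcWeight (hS : S ⊆ edgesIn Λ) :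
    ∑ σ, boltzmann S 1 (bondSpin (spin Λ) ∘ Subtype.val) σ * bcWeight Λ ξ σ =
      2 ^ S.card * 2 ^ (wiredPairs Λ ξ).card * 2 ^ numClusters Λ ξ S := by
  classical
  have hcard := card_forall_adj_eq (α := ℤˣ) (wiredGraph Λ ξ S)
  rw [Nat.card_eq_fintype_card, Nat.card_eq_fintype_card, Fintype.card_units_int,
    Fintype.card_subtype] at hcard
  have hterm (σ : Λ → ℤˣ) :
      boltzmann S 1 (bondSpin (spin Λ) ∘ Subtype.val) σ * bcWeight Λ ξ σ =
        2 ^ S.card * 2 ^ (wiredPairs Λ ξ).card *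
          if ∀ x y, (wiredGraph Λ ξ S).Adj x y → σ x = σ y then 1 else 0 := by
    simp only [bcWeight, boltzmann_one_eq_ite, ite_zero_mul_ite_zero, mul_boole,
      forall_wiredGraph_adj_iff hS]
    congr
  simp only [hterm]
  rw [← Finset.mul_sum, Finset.sum_boole, hcard, numClusters]
  norm_cast

/-- The Edwards–Sokal weight of a set of open edges and a spin configuration, which is zero unless
the spins are constant on clusters. -/
def jointWeight (p : ℝ) (Λ : Finset (ℤ × ℤ)) (ξ : BoundaryCondition Λ)
    (S : Finset squareLattice.edgeSet) (σ : Λ → ℤˣ) : ℝ :=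
  (p / 2) ^ S.card * (1 - p) ^ ((edgesIn Λ).card - S.card) *
    (boltzmann S 1 (bondSpin (spin Λ) ∘ Subtype.val) σ * bcWeight Λ ξ σ)

theorem jointWeight_posType (hp0 : 0 ≤ p) (hp1 : p ≤ 1) : PosType (jointWeight p Λ ξ S) :=
  ((boltzmann_posType fun _ _ => zero_le_one).mul bcWeight_posType).smul _
    (mul_nonneg (pow_nonneg (by linarith) _) (pow_nonneg (by linarith) _))

theorem sum_jointWeight (hS : S ⊆ edgesIn Λ) :
    ∑ σ, jointWeight p Λ ξ S σ = 2 ^ (wiredPairs Λ ξ).card * weight p 2 Λ ξ S := by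
  simp only [jointWeight]
  rw [← Finset.mul_sum, sum_boltzmann_one_mul_bcWeight hS, weight, div_pow]
  field_simp

theorem sum_powerset_jointWeight (hp : p < 2) (σ : Λ → ℤˣ) :
    ∑ S ∈ (edgesIn Λ).powerset, jointWeight p Λ ξ S σ =
      (1 - p / 2) ^ (edgesIn Λ).card * isingWeight (p / (2 - p)) Λ ξ σ := by
  have hsum : p / 2 + (1 - p) = 1 - p / 2 := by ring
  have hratio : p / 2 / (1 - p / 2) = p / (2 - p) := by
    have : 2 - p ≠ 0 := by linarith
    field_simp
  have h := sum_powerset_mul_boltzmann_one (F := edgesIn Λ) (a := p / 2) (b := 1 - p)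
    (χ := bondSpin (spin Λ) ∘ Subtype.val) (by linarith) σ
  rw [hsum, hratio] at h
  simp only [jointWeight, isingWeight, ← mul_assoc]
  rw [← Finset.sum_mul, h]

theorem mul_partitionFunction (hp : p < 2) :
    2 ^ (wiredPairs Λ ξ).card * partitionFunction p 2 Λ ξ =
      (1 - p / 2) ^ (edgesIn Λ).card * ∑ σ, isingWeight (p / (2 - p)) Λ ξ σ := by
  rw [partitionFunction, Finset.mul_sum, Finset.mul_sum]
  simp only [← sum_powerset_jointWeight hp]
  rw [Finset.sum_comm]
  exact Finset.sum_congr rfl fun S hS => (sum_jointWeight (Finset.mem_powerset.1 hS)).symm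

open Classical in
theorem mul_sum_weight_connected_le (hp0 : 0 ≤ p) (hp1 : p ≤ 1) (x y : ℤ × ℤ) :
    2 ^ (wiredPairs Λ ξ).card * ∑ S ∈ (edgesIn Λ).powerset with Connected (ofOpenEdges S) x y,
        weight p 2 Λ ξ S ≤
      (1 - p / 2) ^ (edgesIn Λ).card *
        ∑ σ, (spin Λ x * spin Λ y) σ * isingWeight (p / (2 - p)) Λ ξ σ := by
  have hcorr : (1 - p / 2) ^ (edgesIn Λ).card *
        ∑ σ, (spin Λ x * spin Λ y) σ * isingWeight (p / (2 - p)) Λ ξ σ =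
      ∑ S ∈ (edgesIn Λ).powerset, ∑ σ, (spin Λ x * spin Λ y) σ * jointWeight p Λ ξ S σ := by
    rw [Finset.sum_comm, Finset.mul_sum]
    refine Finset.sum_congr rfl fun σ _ => ?_
    rw [← Finset.mul_sum, sum_powerset_jointWeight (by linarith)]
    ring
  have hconn : ∀ S ∈ (edgesIn Λ).powerset, Connected (ofOpenEdges S) x y →
      ∑ σ, (spin Λ x * spin Λ y) σ * jointWeight p Λ ξ S σ =
        2 ^ (wiredPairs Λ ξ).card * weight p 2 Λ ξ S := by
    intro S hS hxy
    rw [← sum_jointWeight (Finset.mem_powerset.1 hS)]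
    refine Finset.sum_congr rfl fun σ _ => ?_
    rw [jointWeight, mul_left_comm, ← mul_assoc ((spin Λ x * spin Λ y) σ),
      (linked_of_connected hxy).spin_mul_spin_mul_boltzmann_eq]
  rw [hcorr, Finset.mul_sum]
  refine (Finset.sum_congr rfl fun S hS => ?_).trans_le
    (Finset.sum_le_sum_of_subset_of_nonneg (Finset.filter_subset _ _) fun S _ _ =>
      ((jointWeight_posType hp0 hp1).char_mul (spin Λ x * spin Λ y)).sum_nonneg)
  exact (hconn S (Finset.mem_of_mem_filter S hS) (Finset.mem_filter.1 hS).2).symm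

theorem weight_nonneg (hp0 : 0 ≤ p) (hp1 : p ≤ 1) (hq : 0 ≤ q) : 0 ≤ weight p q Λ ξ S :=
  mul_nonneg (mul_nonneg (pow_nonneg hp0 _) (pow_nonneg (by linarith) _)) (pow_nonneg hq _)

open Classical in
theorem finiteVolume_apply (hp0 : 0 ≤ p) (hp1 : p ≤ 1) (hq : 0 ≤ q) (A : Set Config) :
    finiteVolume p q Λ ξ A = ENNReal.ofReal
      ((∑ S ∈ (edgesIn Λ).powerset with ofOpenEdges S ∈ A, weight p q Λ ξ S) /
        partitionFunction p q Λ ξ) := by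
  have hZ : 0 ≤ partitionFunction p q Λ ξ :=
    Finset.sum_nonneg fun S _ => weight_nonneg hp0 hp1 hq
  rw [finiteVolume, Measure.finsetSum_apply, Finset.sum_div, ENNReal.ofReal_sum_of_nonneg
    fun S _ => div_nonneg (weight_nonneg hp0 hp1 hq) hZ, Finset.sum_filter]
  refine Finset.sum_congr rfl fun S _ => ?_
  by_cases h : ofOpenEdges S ∈ A <;> simp [h]

theorem finiteVolume_connected_le (hp0 : 0 ≤ p) (hp1 : p ≤ 1) (x y : ℤ × ℤ) :
    finiteVolume p 2 Λ ξ {ω | Connected ω x y} ≤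
      ENNReal.ofReal (twoPoint (p / (2 - p)) Λ ξ x y) := by
  classical
  have ht0 : 0 ≤ p / (2 - p) := div_nonneg hp0 (by linarith)
  have ht1 : p / (2 - p) ≤ 1 := div_le_one_of_le₀ (by linarith) (by linarith)
  have hpairs : (0 : ℝ) < 2 ^ (wiredPairs Λ ξ).card := by positivity
  have hedges : 0 < (1 - p / 2) ^ (edgesIn Λ).card := pow_pos (by linarith) _
  rw [finiteVolume_apply hp0 hp1 zero_le_two, twoPoint, ← mul_div_mul_left _ _ hpairs.ne',
    ← mul_div_mul_left _ (∑ σ, isingWeight _ Λ ξ σ) hedges.ne', mul_partitionFunction (by linarith)]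
  refine ENNReal.ofReal_le_ofReal (div_le_div_of_nonneg_right ?_ ?_)
  · exact mul_sum_weight_connected_le hp0 hp1 x y
  · exact mul_nonneg hedges.le (sum_isingWeight_pos ht0 ht1).le

end EdwardsSokal

/-! ### Exponential decay -/

section Decay

variable {t r α : ℝ} {Λ : Finset (ℤ × ℤ)} {ξ : BoundaryCondition Λ} {m : ℕ}

theorem twoPoint_le_pow (ht0 : 0 ≤ t) (ht1 : t < 1) (hm : m ≠ 0)
    (hα : dualRatio t ^ m * (8 * m) ≤ α) {x : ℤ × ℤ} (k : ℕ) :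
    ∀ y, (∀ z, supDist y z ≤ k * m → z ∈ Λ) → k * m ≤ supDist y x →
      twoPoint t Λ ξ y x ≤ α ^ k := by
  have hr : 0 ≤ dualRatio t ^ m := pow_nonneg (dualRatio_nonneg ht0 ht1) m
  have hα0 : 0 ≤ α := (by positivity : 0 ≤ dualRatio t ^ m * (8 * m)).trans hα
  induction k with
  | zero => exact fun y _ _ => (twoPoint_le_one ht0 ht1.le y x).trans_eq (pow_zero α).symm
  | succ k ih =>
    intro y hΛ hx
    rw [add_one_mul] at hΛ hx
    have hsphere : ∀ u ∈ sphere y m, twoPoint t Λ ξ u x ≤ α ^ k := by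
      intro u hu
      rw [mem_sphere] at hu
      refine ih u (fun z hz => hΛ z ?_) ?_
      · have := supDist_triangle y u z
        omega
      · have := supDist_triangle y u x
        omega
    have hcard : ((sphere y m).card : ℝ) ≤ 8 * m := by exact_mod_cast card_sphere_le hm y
    calc twoPoint t Λ ξ y x ≤ dualRatio t ^ m * ∑ u ∈ sphere y m, twoPoint t Λ ξ u x :=
          twoPoint_le_sum_sphere ht0 ht1 hm (fun z hz => hΛ z (by omega)) (by omega)
      _ ≤ dualRatio t ^ m * ((sphere y m).card * α ^ k) := by
          gcongr
          simpa only [nsmul_eq_mul] using Finset.sum_le_card_nsmul _ _ _ hsphere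
      _ ≤ dualRatio t ^ m * (8 * m * α ^ k) := by gcongr
      _ = dualRatio t ^ m * (8 * m) * α ^ k := by ring
      _ ≤ α * α ^ k := by gcongr
      _ = α ^ (k + 1) := (pow_succ' α k).symm

theorem exists_pow_mul_le {C ε : ℝ} (hr0 : 0 ≤ r) (hr1 : r < 1) (hε : 0 < ε) :
    ∃ m : ℕ, m ≠ 0 ∧ r ^ m * (C * m) ≤ ε := by
  have hlim : Tendsto (fun m : ℕ => r ^ m * (C * m)) atTop (𝓝 0) := by
    simpa only [mul_zero, mul_left_comm, mul_comm] using
      (tendsto_self_mul_const_pow_of_lt_one hr0 hr1).const_mul C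
  exact ((eventually_ne_atTop 0).and (hlim.eventually (eventually_le_nhds hε))).exists

theorem div_two_sub_lt_sqrt_two_sub_one {p : ℝ} (hp : p < √2 / (1 + √2)) :
    p / (2 - p) < √2 - 1 := by
  have hs : √2 * √2 = 2 := Real.mul_self_sqrt zero_le_two
  have hs0 : 0 < √2 := by positivity
  have hcrit : √2 / (1 + √2) = 2 - √2 := by
    field_simp
    linear_combination hs
  rw [hcrit] at hp
  rw [div_lt_iff₀ (by linarith)]
  nlinarith

theorem dualRatio_lt_one (ht0 : 0 ≤ t) (ht : t < √2 - 1) : dualRatio t < 1 := by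
  have hs : √2 * √2 = 2 := Real.mul_self_sqrt zero_le_two
  have ht1 : 0 < 1 - t := by nlinarith
  rw [dualRatio, ← mul_div_assoc, div_lt_one ht1]
  nlinarith

theorem pow_le_exp_neg {a : ℝ} {n k l : ℕ} (ha0 : 0 < a) (ha1 : a ≤ 1) (hl : l ≠ 0)
    (hn : n ≤ l * k) : a ^ k ≤ Real.exp (-(-Real.log a / l) * n) := by
  have hl0 : (0 : ℝ) < l := by positivity
  have hnk : (n : ℝ) / l ≤ k := by
    rw [div_le_iff₀ hl0, mul_comm]
    exact_mod_cast hn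
  calc a ^ k = Real.exp (k * Real.log a) := by
        rw [Real.exp_nat_mul, Real.exp_log ha0]
    _ ≤ Real.exp (n / l * Real.log a) :=
        Real.exp_le_exp.2 (mul_le_mul_of_nonpos_right hnk (Real.log_nonpos ha0.le ha1))
    _ = Real.exp (-(-Real.log a / l) * n) := by
        congr 1
        ring

theorem exists_twoPoint_le_exp (ht0 : 0 ≤ t) (ht1 : t < 1) (hr : dualRatio t < 1) :
    ∃ c : ℝ, 0 < c ∧ ∀ (Λ : Finset (ℤ × ℤ)) (ξ : BoundaryCondition Λ) (x y : ℤ × ℤ),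
      (∀ z, supDist y z ≤ supDist y x → z ∈ Λ) →
        twoPoint t Λ ξ y x ≤ Real.exp (-c * supDist y x) := by
  obtain ⟨m, hm, hα⟩ := exists_pow_mul_le (C := 8) (dualRatio_nonneg ht0 ht1) hr one_half_pos
  let ρ := ((1 - t) / (1 + t)) ^ 4
  have hρ : 0 < ρ := pow_pos (div_pos (by linarith) (by linarith)) _
  let a := max ((1 - ρ) / (1 + ρ)) (1 / 2)
  have ha0 : 0 < a := lt_max_of_lt_right one_half_pos
  have ha1 : a < 1 := max_lt ((div_lt_one (by linarith)).2 (by linarith)) one_half_lt_one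
  have hl : 2 * m ≠ 0 := mul_ne_zero two_ne_zero hm
  refine ⟨-Real.log a / (2 * m : ℕ),
    div_pos (neg_pos.2 (Real.log_neg ha0 ha1)) (Nat.cast_pos.2 (Nat.pos_of_ne_zero hl)),
    fun Λ ξ x y hΛ => ?_⟩
  obtain h0 | hpos := (supDist y x).eq_zero_or_pos
  · rw [h0, Nat.cast_zero, mul_zero, Real.exp_zero]
    exact twoPoint_le_one ht0 ht1.le y x
  obtain hlt | hle := lt_or_ge (supDist y x) m
  · have hxy : x ≠ y := by
      rintro rfl
      exact hpos.ne' (supDist_self x)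
    have hy : supDist y y < supDist y x := by rwa [supDist_self]
    calc twoPoint t Λ ξ y x ≤ (1 - ρ) / (1 + ρ) :=
          twoPoint_le_of_ne ht0 ht1 hxy (hΛ y hy.le) (notMem_boundary_of_supDist_lt hΛ hy)
      _ ≤ a ^ 1 := (le_max_left _ _).trans_eq (pow_one a).symm
      _ ≤ _ := pow_le_exp_neg ha0 ha1.le hl (by omega)
  · have hdiv : supDist y x / m * m ≤ supDist y x := Nat.div_mul_le_self _ _
    calc twoPoint t Λ ξ y x ≤ (1 / 2) ^ (supDist y x / m) :=
          twoPoint_le_pow ht0 ht1 hm hα _ y (fun z hz => hΛ z (hz.trans hdiv)) hdiv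
      _ ≤ a ^ (supDist y x / m) := by
          gcongr
          exact le_max_right _ _
      _ ≤ _ := by
          refine pow_le_exp_neg ha0 ha1.le hl ?_
          have hone : 1 ≤ supDist y x / m := (Nat.one_le_div_iff (by omega)).2 hle
          have hlt := Nat.lt_mul_div_succ (supDist y x) (Nat.pos_of_ne_zero hm)
          nlinarith

end Decay

/-! ### Passage to infinite volume -/

section InfiniteVolume

variable {E E' : Finset squareLattice.edgeSet} {ω ω' : Config} {x y : ℤ × ℤ}

theorem openGraph_adj :
    (openGraph ω).Adj x y ↔ ∃ h : s(x, y) ∈ squareLattice.edgeSet, ω ⟨s(x, y), h⟩ = true := by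
  simp only [openGraph, SimpleGraph.fromEdgeSet_adj, Set.mem_ofPred_eq, and_iff_left_iff_imp]
  rintro ⟨h, -⟩
  exact ((SimpleGraph.mem_edgeSet _).1 h).ne

theorem Connected.mono (hω : ∀ e, ω e = true → ω' e = true) (h : Connected ω x y) :
    Connected ω' x y := by
  refine SimpleGraph.Reachable.mono (fun a b hab => ?_) h
  obtain ⟨he, hopen⟩ := openGraph_adj.1 hab
  exact openGraph_adj.2 ⟨he, hω _ hopen⟩

open Classical in
/-- The configuration that agrees with `η` on `E` and whose edges outside `E` are closed. -/
def extendClosed (E : Finset squareLattice.edgeSet) (η : E → Bool) : Config :=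
  fun e => if h : e ∈ E then η ⟨e, h⟩ else false

theorem extendClosed_restrict_eq_true_iff {e : squareLattice.edgeSet} :
    extendClosed E (E.restrict ω) e = true ↔ e ∈ E ∧ ω e = true := by
  unfold extendClosed
  split_ifs with h <;> simp [h]

theorem Connected.exists_extendClosed (h : Connected ω x y) :
    ∃ E, Connected (extendClosed E (E.restrict ω)) x y := by
  classical
  obtain ⟨w⟩ := h
  induction w with
  | nil => exact ⟨∅, SimpleGraph.Reachable.rfl⟩
  | cons hadj _ ih =>
    obtain ⟨E, hE⟩ := ih
    obtain ⟨he, hopen⟩ := openGraph_adj.1 hadj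
    refine ⟨insert ⟨_, he⟩ E, SimpleGraph.Reachable.trans (SimpleGraph.Adj.reachable ?_)
      (hE.mono fun e => ?_)⟩
    · exact openGraph_adj.2
        ⟨he, extendClosed_restrict_eq_true_iff.2 ⟨Finset.mem_insert_self _ _, hopen⟩⟩
    · simp only [extendClosed_restrict_eq_true_iff]
      exact And.imp_left Finset.mem_insert_of_mem

theorem setOf_connected_eq_iUnion_cylinder (x y : ℤ × ℤ) :
    {ω | Connected ω x y} =
      ⋃ E, cylinder (α := fun _ => Bool) E {η | Connected (extendClosed E η) x y} := by
  ext ω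
  simp only [Set.mem_iUnion]
  refine ⟨Connected.exists_extendClosed, ?_⟩
  rintro ⟨E, hE⟩
  exact Connected.mono (fun e he => (extendClosed_restrict_eq_true_iff.1 he).2) hE

theorem monotone_cylinder_connected (x y : ℤ × ℤ) :
    Monotone fun E : Finset squareLattice.edgeSet =>
      cylinder (α := fun _ => Bool) E {η | Connected (extendClosed E η) x y} := by
  refine fun E E' hEE' ω hω => Connected.mono (fun e => ?_) hω
  simp only [extendClosed_restrict_eq_true_iff]
  exact And.imp_left fun he => hEE' he

theorem IsInfiniteVolume.measure_connected_le {p q : ℝ} {φ : Measure Config}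
    (hφ : IsInfiniteVolume p q φ) {b : ENNReal}
    (hb : ∀ᶠ N in atTop, ∀ ξ, finiteVolume p q (box N) ξ {ω | Connected ω x y} ≤ b) :
    φ {ω | Connected ω x y} ≤ b := by
  obtain ⟨-, N, ξ, hN, hlim⟩ := hφ
  rw [setOf_connected_eq_iUnion_cylinder, (monotone_cylinder_connected x y).measure_iUnion]
  refine iSup_le fun E => le_of_tendsto (hlim E _) ?_
  filter_upwards [hN.tendsto_atTop.eventually hb] with k hk
  refine (measure_mono ?_).trans (hk (ξ k))
  rw [setOf_connected_eq_iUnion_cylinder]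
  exact Set.subset_iUnion_of_subset E subset_rfl

theorem mem_box {N : ℕ} : x ∈ box N ↔ supDist 0 x ≤ N := by
  simp only [box, Finset.mem_product, Finset.mem_Icc, supDist, Prod.fst_zero, Prod.snd_zero]
  omega

theorem eventually_forall_supDist_le_mem_box (y : ℤ × ℤ) (n : ℕ) :
    ∀ᶠ N in atTop, ∀ z, supDist y z ≤ n → z ∈ box N := by
  filter_upwards [eventually_ge_atTop (supDist 0 y + n)] with N hN z hz
  have := supDist_triangle 0 y z
  exact mem_box.2 (by omega)

theorem cast_supDist (x y : ℤ × ℤ) : (supDist x y : ℝ) = dist x y := by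
  rw [Prod.dist_eq, Int.dist_eq, Int.dist_eq, supDist, Nat.cast_max, Nat.cast_natAbs,
    Nat.cast_natAbs, Int.cast_abs, Int.cast_abs, Int.cast_sub, Int.cast_sub]

end InfiniteVolume

end FK

end

theorem mainTheorem6_general (p : ℝ) (hp₀ : 0 ≤ p) (hp : p < √2 / (1 + √2)) :
    ∃ ξ : ℝ, 0 < ξ ∧
      ∀ φ : MeasureTheory.Measure FK.Config, FK.IsInfiniteVolume p 2 φ →
        ∀ x y : ℤ × ℤ, φ.real {ω | FK.Connected ω x y} ≤ Real.exp (-ξ * dist x y) := by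
  have hp1 : p < 1 := hp.trans ((div_lt_one (by positivity)).2 (lt_one_add _))
  have ht0 : 0 ≤ p / (2 - p) := div_nonneg hp₀ (by linarith)
  have ht1 : p / (2 - p) < 1 := (div_lt_one (by linarith)).2 (by linarith)
  have hr := FK.dualRatio_lt_one ht0 (FK.div_two_sub_lt_sqrt_two_sub_one hp)
  obtain ⟨ξ, hξ, hdecay⟩ := FK.exists_twoPoint_le_exp ht0 ht1 hr
  refine ⟨ξ, hξ, fun φ hφ x y => ENNReal.toReal_le_of_le_ofReal (Real.exp_nonneg _) ?_⟩
  refine hφ.measure_connected_le ?_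
  filter_upwards [FK.eventually_forall_supDist_le_mem_box x (FK.supDist x y)] with N hN η
  refine (FK.finiteVolume_connected_le hp₀ hp1.le x y).trans (ENNReal.ofReal_le_ofReal ?_)
  rw [← FK.cast_supDist]
  exact hdecay (FK.box N) η y x hN

theorem mainTheorem6 (p : ℝ) (hp₀ : 0 ≤ p) (hp : p < √2 / (1 + √2)) :
    ∃ ξ : ℝ, 0 < ξ ∧
      ∀ φ : MeasureTheory.Measure FK.Config, FK.IsInfiniteVolume p 2 φ →
        ∀ n : ℕ, φ.real {ω | FK.Connected ω (0, 0) (0, (n : ℤ))} ≤ Real.exp (-ξ * n) := by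
  obtain ⟨ξ, hξ, h⟩ := mainTheorem6_general p hp₀ hp
  exact ⟨ξ, hξ, fun φ hφ n => by simpa [Prod.dist_eq, Int.dist_eq] using h φ hφ (0, 0) (0, n)⟩
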